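/- **Setting.** Fix integers $n,m,d\ge 0$, $T>0$, $x_0\in\mathbb R^n$, $a_0=(a_{0,1},\dots,a_{0,m})\in(\mathbb R^n)^m$, $b_0\in\mathbb R^m$, $K\in\mathbb R$, $U\subset\mathbb R^d$, a mapping $g:\mathbb R^n\times\mathbb R^d\to\mathbb R^n$, a terminal cost $\varphi:\mathbb R^n\to(-\infty,\infty]$ and a running cost $\ell(t,x,a,b,u,\dot x,\dot a,\dot b)\in[-\infty,\infty]$, $t\in[0,T]$. Here $\|\cdot\|$ is the Euclidean norm, and $N(x;C)=\{v:\langle v,y-x\rangle\le 0\ \forall y\in C\}$ if $x\in C$, $N(x;C)=\emptyset$ if $x\notin C$. A pair $(a,b)$ with $a_i\in W^{1,2}([0,T];\mathbb R^n)$ and $b_i\in W^{1,2}([0,T];\mathbb R)$, $i=1,\dots,m$, is called *admissible* if $a(0)=a_0$, $b(0)=b_0$, $\|a_i(t)\|=1$ for all $t\in[0,T]$ and all $i$, and (H2) $\|\dot a_i(t)\|\le K$ and $|\dot b_i(t)|\le K$ for a.e. $t\in[0,T]$ and all $i$. For such a pair put $C(t)=\{x\in\mathbb R^n:\langle a_i(t),x\rangle\le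 b_i(t),\ i=1,\dots,m\}$. Problem $(P)$ is to minimize $$J[x,a,b,u]=\varphi(x(T))+\int_0^T\ell\big(t,x(t),a(t),b(t),u(t),\dot x(t),\dot a(t),\dot b(t)\big)\,dt$$ over all *feasible* quadruples: $x\in W^{1,2}([0,T];\mathbb R^n)$, $(a,b)$ admissible, $u\in L^2([0,T];\mathbb R^d)$, $x(0)=x_0$, $x(t)\in C(t)$ for all $t\in[0,T]$, $u(t)\in U$ and $\dot x(t)\in -N(x(t);C(t))+g(x(t),u(t))$ for a.e. $t\in[0,T]$, and the running cost along the quadruple is integrable on $[0,T]$ (in particular finite a.e.). **Assumptions.** (H1) $U$ is closed and bounded. (H3) There are $L,M>0$ with $\|g(x_1,u_1)-g(x_2,u_2)\|\le L(\|x_1-x_2\|+\|u_1-u_2\|)$ for all $(x_1,u_1),(x_2,u_2)\in\mathbb R^n\times U$, and $\|g(x,u)\|\le M(1+\|x\|)$ for all $(x,u)\in\mathbb R^n\times U$. (H4) For every admissible pair $(a,b)$ there are $v_i\in W^{1,2}([0,T];\mathbb R)$ with $\|a_i(t)-a_i(s)\|\le|v_i(t)-v_i(s)|$ for all $s,t\in[0,T]$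 and $i=1,\dots,m$, and there is a continuous $\vartheta:[0,T]\to\mathbb R$ with $\sup_{[0,T]}\vartheta<0$ such that for every $t\in[0,T]$ some $x\in\mathbb R^n$ satisfies $\langle a_i(t),x\rangle-b_i(t)<\vartheta(t)$ for all $i=1,\dots,m$. (H5) $\varphi$ is lower semicontinuous. There is $c\in\mathbb R$ such that for a.e. $t\in[0,T]$ one has $\ell(t,\cdot)\ge c$, the function $\ell(t,\cdot)$ is lower semicontinuous in all its variables, and for all values of the other variables $\ell$ is continuous in time at $t$ (relative to $[0,T]$). **Theorem 3.1.** Assume (H1)–(H5). Suppose that $\ell$ does not depend on $u$ and that, for a.e. $t$ and all $(x,a,b)$, it is convex as a function of $(\dot x,\dot a,\dot b)$. Suppose furthermore that there is a minimizing sequence of feasible quadruples $(x^k,a^k,b^k,u^k)$, that is, $J[x^k,a^k,b^k,u^k]\to\inf(P)$, such that * there is a summable function $\kappa$ on $[0,T]$ with $\ell\big(t,x^k(t),a^k(t),b^k(t),u^k(t),\dot x^k(t),\dot a^k(t),\dot b^k(t)\big)\le\kappa(t)$ for every $k$ and a.e. $t\in[0,T]$; * $\{(x^k,a^k,b^k)\}$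 is bounded in $W^{1,2}([0,T];\mathbb R^n\times\mathbb R^{mn}\times\mathbb R^m)$; * the set $g(x^k(t),U)=\{g(x^k(t),u):u\in U\}$ is convex for every $k$ and every $t\in[0,T]$. Then $(P)$ has an optimal solution: there is a feasible quadruple $(\bar x,\bar a,\bar b,\bar u)\in W^{1,2}([0,T];\mathbb R^{n+mn+m})\times L^2([0,T];\mathbb R^d)$ with $J[\bar x,\bar a,\bar b,\bar u]\le J[x,a,b,u]$ for every feasible $(x,a,b,u)$. -/

import Mathlib

open MeasureTheory Set Filter Topology
open scoped NNReal ENNReal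

noncomputable section

namespace Sweeping

/-- Euclidean space of dimension `n`. -/
abbrev E (n : ℕ) := EuclideanSpace ℝ (Fin n)

/-- Values `(x, a, b)` of a trajectory together with the controls in the moving set; the same type
is used for the velocities. -/
abbrev State (n m : ℕ) := E n × (Fin m → E n) × (Fin m → ℝ)

/-- Lebesgue measure on `[0, T]`. -/
def leb (T : ℝ) : Measure ℝ := volume.restrict (Icc 0 T)

/-- `f ∈ W^{1,2}([0,T]; F)`: on `[0,T]`, `f` is the integral of a square integrable function
(which then equals the a.e. existing derivative `deriv f` almost everywhere on `[0,T]`). Only the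
values of `f` on `[0,T]` matter. -/
def IsW12 {F : Type*} [NormedAddCommGroup F] [NormedSpace ℝ F] (T : ℝ) (f : ℝ → F) : Prop :=
  ∃ v : ℝ → F, MemLp v 2 (leb T) ∧ ∀ t ∈ Icc (0 : ℝ) T, f t = f 0 + ∫ s in (0 : ℝ)..t, v s

/-- The norm of `W^{1,2}([0,T]; F)` (for functions of that space). -/
def w12Norm {F : Type*} [NormedAddCommGroup F] [NormedSpace ℝ F] (T : ℝ) (f : ℝ → F) : ℝ≥0∞ :=
  eLpNorm f 2 (leb T) + eLpNorm (deriv f) 2 (leb T)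

/-- The normal cone of convex analysis to `C` at `x`; it is empty when `x ∉ C`. -/
def normalCone {n : ℕ} (x : E n) (C : Set (E n)) : Set (E n) :=
  {ζ | x ∈ C ∧ ∀ y ∈ C, inner ℝ ζ (y - x) ≤ 0}

/-- The polyhedron `{x | ⟨a i, x⟩ ≤ b i for all i}`. -/
def polyhedron {n m : ℕ} (a : Fin m → E n) (b : Fin m → ℝ) : Set (E n) :=
  {x | ∀ i, inner ℝ (a i) x ≤ b i}

/-- The data of an optimal control problem for a controlled sweeping process. -/
structure Problem (n m d : ℕ) where
  /-- final time -/
  T : ℝ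
  /-- initial state -/
  x₀ : E n
  /-- initial values of the controls `a` -/
  a₀ : Fin m → E n
  /-- initial values of the controls `b` -/
  b₀ : Fin m → ℝ
  /-- uniform bound for the velocities of the controls `a` and `b` -/
  K : ℝ
  /-- control set of the perturbation -/
  U : Set (E d)
  /-- perturbation mapping -/
  g : E n → E d → E n
  /-- terminal cost -/
  φ : E n → EReal
  /-- running cost `ℓ(t, (x, a, b), u, (ẋ, ȧ, ḃ))` -/
  ℓ : ℝ → State n m → E d → State n m → EReal

/-- A quadruple `(x, a, b, u)` of functions of time. -/
structure Quadruple (n m d : ℕ) where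
  /-- trajectory -/
  x : ℝ → E n
  /-- normals of the moving polyhedron -/
  a : Fin m → ℝ → E n
  /-- right-hand sides of the moving polyhedron -/
  b : Fin m → ℝ → ℝ
  /-- control in the perturbation -/
  u : ℝ → E d

namespace Quadruple

variable {n m d : ℕ}

/-- The point `(x(t), a(t), b(t))`. -/
def pos (q : Quadruple n m d) (t : ℝ) : State n m :=
  (q.x t, fun i => q.a i t, fun i => q.b i t)

/-- The velocity `(ẋ(t), ȧ(t), ḃ(t))`. -/
def vel (q : Quadruple n m d) (t : ℝ) : State n m :=
  (deriv q.x t, fun i => deriv (q.a i) t, fun i => deriv (q.b i) t)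

/-- The moving set `C(t)`. -/
def C (q : Quadruple n m d) (t : ℝ) : Set (E n) :=
  polyhedron (fun i => q.a i t) (fun i => q.b i t)

end Quadruple

namespace Problem

variable {n m d : ℕ}

/-- Admissible controls in the moving set: `W^{1,2}` functions with the prescribed initial values,
with velocities bounded by `K` and with unit normals `a i`. -/
structure AdmissibleControls (P : Problem n m d) (a : Fin m → ℝ → E n) (b : Fin m → ℝ → ℝ) :
    Prop where
  a_w12 : ∀ i, IsW12 P.T (a i)
  b_w12 : ∀ i, IsW12 P.T (b i)
  a_init : ∀ i, a i 0 = P.a₀ i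
  b_init : ∀ i, b i 0 = P.b₀ i
  a_bound : ∀ i, ∀ᵐ t ∂(leb P.T), ‖deriv (a i) t‖ ≤ P.K
  b_bound : ∀ i, ∀ᵐ t ∂(leb P.T), ‖deriv (b i) t‖ ≤ P.K
  a_unit : ∀ i, ∀ t ∈ Icc (0 : ℝ) P.T, ‖a i t‖ = 1

/-- The running cost along a quadruple, as a function of time. -/
def runningCost (P : Problem n m d) (q : Quadruple n m d) (t : ℝ) : EReal :=
  P.ℓ t (q.pos t) (q.u t) (q.vel t)

/-- Feasible solutions. The running cost is integrable: finite almost everywhere, with an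
integrable real part. -/
structure Feasible (P : Problem n m d) (q : Quadruple n m d) : Prop where
  x_w12 : IsW12 P.T q.x
  controls : P.AdmissibleControls q.a q.b
  u_l2 : MemLp q.u 2 (leb P.T)
  u_mem : ∀ᵐ t ∂(leb P.T), q.u t ∈ P.U
  x_init : q.x 0 = P.x₀
  x_mem : ∀ t ∈ Icc (0 : ℝ) P.T, q.x t ∈ q.C t
  inclusion : ∀ᵐ t ∂(leb P.T), ∃ ζ ∈ normalCone (q.x t) (q.C t),
    deriv q.x t = -ζ + P.g (q.x t) (q.u t)
  cost_finite : ∀ᵐ t ∂(leb P.T), P.runningCost q t ≠ ⊤ ∧ P.runningCost q t ≠ ⊥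
  cost_integrable : Integrable (fun t => (P.runningCost q t).toReal) (leb P.T)

/-- The cost functional `J`, to be used for feasible solutions. -/
def J (P : Problem n m d) (q : Quadruple n m d) : EReal :=
  P.φ (q.x P.T) + ((∫ t, (P.runningCost q t).toReal ∂(leb P.T) : ℝ) : EReal)

/-- The optimal value of the problem. -/
def value (P : Problem n m d) : EReal := ⨅ q : {q : Quadruple n m d // P.Feasible q}, P.J q

/-- Optimal solutions (global minimizers among the feasible solutions). -/
def IsOptimal (P : Problem n m d) (q : Quadruple n m d) : Prop :=
  P.Feasible q ∧ ∀ q', P.Feasible q' → P.J q ≤ P.J q'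

/-- Minimizing sequences of feasible solutions. -/
def IsMinimizingSeq (P : Problem n m d) (q : ℕ → Quadruple n m d) : Prop :=
  (∀ k, P.Feasible (q k)) ∧ Tendsto (fun k => P.J (q k)) atTop (𝓝 P.value)

/-- The control set is closed and bounded. -/
def H1 (P : Problem n m d) : Prop := IsClosed P.U ∧ Bornology.IsBounded P.U

/-- Lipschitz continuity and sublinear growth of the perturbation mapping. -/
def H3 (P : Problem n m d) : Prop :=
  (∃ L : ℝ, 0 < L ∧ ∀ x₁ x₂ : E n, ∀ u₁ ∈ P.U, ∀ u₂ ∈ P.U,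
    ‖P.g x₁ u₁ - P.g x₂ u₂‖ ≤ L * (‖x₁ - x₂‖ + ‖u₁ - u₂‖)) ∧
  (∃ M : ℝ, 0 < M ∧ ∀ x : E n, ∀ u ∈ P.U, ‖P.g x u‖ ≤ M * (1 + ‖x‖))

/-- The condition on the moving set, imposed on every admissible control pair `(a, b)`: variation
of `a` controlled by `W^{1,2}` functions, and the Slater-type condition. -/
def H4 (P : Problem n m d) : Prop :=
  ∀ a b, P.AdmissibleControls a b →
    (∃ v : Fin m → ℝ → ℝ, (∀ i, IsW12 P.T (v i)) ∧
      ∀ i, ∀ s ∈ Icc (0 : ℝ) P.T, ∀ t ∈ Icc (0 : ℝ) P.T, ‖a i t - a i s‖ ≤ |v i t - v i s|) ∧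
    (∃ θ : ℝ → ℝ, ContinuousOn θ (Icc 0 P.T) ∧ (∃ δ < 0, ∀ t ∈ Icc (0 : ℝ) P.T, θ t ≤ δ) ∧
      ∀ t ∈ Icc (0 : ℝ) P.T, ∃ x : E n, ∀ i, inner ℝ (a i t) x - b i t < θ t)

/-- The terminal cost has values in `(-∞, ∞]` and is l.s.c.; for a.e. `t`, the running cost is
bounded from below, l.s.c. in all its other variables, and continuous in time at `t`. -/
def H5 (P : Problem n m d) : Prop :=
  (∀ x, P.φ x ≠ ⊥) ∧ LowerSemicontinuous P.φ ∧
  (∃ c : ℝ, ∀ᵐ t ∂(leb P.T), ∀ y u w, (c : EReal) ≤ P.ℓ t y u w) ∧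
  (∀ᵐ t ∂(leb P.T), LowerSemicontinuous
    (fun p : State n m × E d × State n m => P.ℓ t p.1 p.2.1 p.2.2)) ∧
  (∀ᵐ t ∂(leb P.T), ∀ y u w, ContinuousWithinAt (fun s => P.ℓ s y u w) (Icc 0 P.T) t)

/-- The running cost does not depend on `u`. -/
def CostIndepControl (P : Problem n m d) : Prop :=
  ∀ t ∈ Icc (0 : ℝ) P.T, ∀ y u u' w, P.ℓ t y u w = P.ℓ t y u' w

/-- The running cost is convex (as an extended-real-valued function: its epigraph is convex) in the
velocity variables. -/
def CostConvexVel (P : Problem n m d) : Prop :=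
  ∀ᵐ t ∂(leb P.T), ∀ y u, Convex ℝ {p : State n m × ℝ | P.ℓ t y u p.1 ≤ (p.2 : EReal)}

end Problem

end Sweeping

end

/-! This is the direct method. A bound in $W^{1,2}$ gives the states $y_k=(x^k,a^k,b^k)$ a common
Hölder modulus, so a subsequence converges uniformly to some $y$
(`exists_subseq_tendstoUniformlyOn`). The velocities and the perturbations $g(x^k,u^k)$ are only
bounded in $L^2$. In place of weak limits, the proof uses Mazur's device: convex combinations of
later and later terms converge in $L^2$ and a.e. (`exists_tail_combination_tendsto_ae`). Everything
required of a velocity then has to survive such combinations while the state moves.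

The bounds by `K` are closed convex conditions. The sets $g(x^k(t),U)$ are convex and converge,
since $g$ is Lipschitz in $x$ uniformly over $U$; hence the limit $\gamma$ of the perturbations
satisfies $\gamma(t)\in g(x(t),U)$, and a measurable selection (`exists_measurable_zero`) yields the
control. The vectors $\zeta_k=g(x^k,u^k)-\dot x^k$ are normals to $C^k(t)$. A point strictly inside
$C(t)$ lies in $C^k(t)$ for large $k$, and replacing $x^k$ by $x$ in the normal inequality costs at
most $\|\zeta_k\|\,\|x^k-x\|$, which tends to zero a.e. along a subsequence. By the Slater condition
strictly interior points approximate all of $C(t)$, so the limit is normal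
(`mem_normalCone_of_tail_combination`). The constraint $\|a_i\|=1$ is not convex, but it concerns
positions only.

For the cost, an affine function strictly below the limit integrand remains below nearby integrands
after adding $\varepsilon\|w\|^2$. Fatou's lemma applied to the convex combinations, followed by
$\varepsilon\to0$, gives lower semicontinuity (`integral_le_of_tail_combination`). Lower
semicontinuity of the terminal cost finishes the proof. -/

/-! ### Convex combinations of the tails of a sequence -/

/-- Weights of a convex combination of the terms with index at least `N`. -/
structure IsTailWeights (N : ℕ) (p : ℕ →₀ ℝ) : Prop where
  nonneg : ∀ j, 0 ≤ p j
  sum_eq_one : ∑ j ∈ p.support, p j = 1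
  le_of_mem : ∀ j ∈ p.support, N ≤ j

namespace IsTailWeights

variable {N : ℕ} {p : ℕ →₀ ℝ}

theorem mono (hp : IsTailWeights N p) {M : ℕ} (h : M ≤ N) : IsTailWeights M p :=
  ⟨hp.nonneg, hp.sum_eq_one, fun j hj => h.trans (hp.le_of_mem j hj)⟩

theorem sum_mem {F : Type*} [AddCommGroup F] [Module ℝ F] (hp : IsTailWeights N p) {S : Set F}
    (hS : Convex ℝ S) {z : ℕ → F} (hz : ∀ j, N ≤ j → z j ∈ S) :
    ∑ j ∈ p.support, p j • z j ∈ S :=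
  hS.sum_mem (fun j _ => hp.nonneg j) hp.sum_eq_one fun j hj => hz j (hp.le_of_mem j hj)

theorem sum_le {z : ℕ → ℝ} {B : ℝ} (hp : IsTailWeights N p) (hz : ∀ j, N ≤ j → z j ≤ B) :
    ∑ j ∈ p.support, p j * z j ≤ B := hp.sum_mem (convex_Iic B) hz

theorem le_sum {z : ℕ → ℝ} {B : ℝ} (hp : IsTailWeights N p) (hz : ∀ j, N ≤ j → B ≤ z j) :
    B ≤ ∑ j ∈ p.support, p j * z j := hp.sum_mem (convex_Ici B) hz

end IsTailWeights

/-- Tail convex combinations of a convergent sequence have the same limit. -/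
theorem tendsto_tail_combination {F : Type*} [NormedAddCommGroup F] [NormedSpace ℝ F]
    {p : ℕ → ℕ →₀ ℝ} (hp : ∀ N, IsTailWeights N (p N)) {z : ℕ → F} {l : F}
    (hz : Tendsto z atTop (𝓝 l)) :
    Tendsto (fun N => ∑ j ∈ (p N).support, p N j • z j) atTop (𝓝 l) := by
  rw [Metric.tendsto_atTop] at hz ⊢
  intro ε hε
  obtain ⟨N₀, hN₀⟩ := hz ε hε
  exact ⟨N₀, fun N hN => (hp N).sum_mem (convex_ball l ε) fun j hj => hN₀ j (hN.trans hj)⟩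

/-- The hull is the linear image of the hull of basis vectors in `ℕ →₀ ℝ`, where the conditions on
weights define a convex set containing those vectors. -/
theorem exists_tailWeights_of_mem_convexHull {F : Type*} [AddCommGroup F] [Module ℝ F] {h : ℕ → F}
    {N : ℕ} {x : F} (hx : x ∈ convexHull ℝ (h '' Ici N)) :
    ∃ p, IsTailWeights N p ∧ ∑ j ∈ p.support, p j • h j = x := by
  have him : h '' Ici N =
      Finsupp.linearCombination ℝ h '' ((fun j => Finsupp.single j (1 : ℝ)) '' Ici N) := by
    rw [image_image]; simp
  rw [him, ← LinearMap.image_convexHull] at hx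
  obtain ⟨p, hp, rfl⟩ := hx
  refine ⟨p, ?_, by rw [Finsupp.linearCombination_apply, Finsupp.sum]⟩
  have key : convexHull ℝ ((fun j => Finsupp.single j (1 : ℝ)) '' Ici N) ⊆
      {p : ℕ →₀ ℝ | (∀ j, 0 ≤ p j) ∧ Finsupp.linearCombination ℝ (fun _ => (1 : ℝ)) p = 1 ∧
        ∀ j, j < N → p j = 0} := by
    refine convexHull_min ?_ ?_
    · rintro _ ⟨j, hj, rfl⟩
      refine ⟨fun i => ?_, by simp, fun i hi => ?_⟩
      · exact Finsupp.single_nonneg.2 zero_le_one i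
      · exact Finsupp.single_eq_of_ne (by simp at hj; omega)
    · rintro p ⟨h1, h2, h3⟩ q ⟨h1', h2', h3'⟩ s t hs ht hst
      refine ⟨fun j => ?_, ?_, fun j hj => ?_⟩
      · simpa using add_nonneg (mul_nonneg hs (h1 j)) (mul_nonneg ht (h1' j))
      · rw [map_add, map_smul, map_smul, h2, h2']; simpa using hst
      · simp [h3 j hj, h3' j hj]
  obtain ⟨h1, h2, h3⟩ := key hp
  refine ⟨h1, by simpa [Finsupp.linearCombination_apply, Finsupp.sum] using h2, fun j hj => ?_⟩
  by_contra hlt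
  exact (Finsupp.mem_support_iff.1 hj) (h3 j (not_le.1 hlt))

/-- A bounded sequence in a Hilbert space has strongly convergent tail convex combinations. -/
theorem exists_tendsto_tail_combination {H : Type*} [NormedAddCommGroup H] [InnerProductSpace ℝ H]
    [CompleteSpace H] {h : ℕ → H} {R : ℝ} (hR : ∀ k, ‖h k‖ ≤ R) :
    ∃ p : ℕ → ℕ →₀ ℝ, (∀ N, IsTailWeights N (p N)) ∧
      ∃ l, Tendsto (fun N => ∑ j ∈ (p N).support, p N j • h j) atTop (𝓝 l) := by
  set K : ℕ → Set H := fun N => closure (convexHull ℝ (h '' Ici N)) with hK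
  have hKc : ∀ N, Convex ℝ (K N) := fun N => (convex_convexHull ℝ _).closure
  have hmem : ∀ N, h N ∈ K N := fun N =>
    subset_closure (subset_convexHull ℝ _ (mem_image_of_mem h (mem_Ici.2 le_rfl)))
  have hanti : ∀ N M, N ≤ M → K M ⊆ K N := fun N M hNM =>
    closure_mono (convexHull_mono (image_mono (Ici_subset_Ici.2 hNM)))
  -- `v N` is the element of least norm in the closed hull of the `N`-th tail. The hulls decrease,
  -- so these norms increase and stay bounded; the projection inequality `hsq` turns convergence of
  -- the squared norms into the Cauchy property.
  have hv : ∀ N, ∃ v ∈ K N, ∀ w ∈ K N, inner ℝ (0 - v) (w - v) ≤ 0 := fun N => by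
    obtain ⟨v, hv, hv'⟩ := exists_norm_eq_iInf_of_complete_convex ⟨h N, hmem N⟩
      isClosed_closure.isComplete (hKc N) 0
    exact ⟨v, hv, (norm_eq_iInf_iff_real_inner_le_zero (hKc N) hv).1 hv'⟩
  choose v hvK hv using hv
  have hsq : ∀ N, ∀ w ∈ K N, ‖w - v N‖ ^ 2 ≤ ‖w‖ ^ 2 - ‖v N‖ ^ 2 := fun N w hw => by
    have h1 := hv N w hw
    have h2 : ‖w‖ ^ 2 = ‖w - v N‖ ^ 2 + 2 * inner ℝ (w - v N) (v N) + ‖v N‖ ^ 2 := by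
      rw [← norm_add_sq_real, sub_add_cancel]
    rw [zero_sub, inner_neg_left, real_inner_comm] at h1
    linarith
  have hmono : Monotone fun N => ‖v N‖ ^ 2 := fun N M hNM => by
    have := hsq N (v M) (hanti N M hNM (hvK M))
    have h0 := sq_nonneg ‖v M - v N‖
    simp only; linarith
  have hbdd : BddAbove (range fun N => ‖v N‖ ^ 2) := by
    refine ⟨R ^ 2, ?_⟩
    rintro _ ⟨N, rfl⟩
    have := hsq N (h N) (hmem N)
    have h0 := sq_nonneg ‖h N - v N‖
    have := pow_le_pow_left₀ (norm_nonneg _) (hR N) 2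
    simp only; linarith
  have hcau : CauchySeq v := by
    have hc := (tendsto_atTop_ciSup hmono hbdd).cauchySeq
    rw [Metric.cauchySeq_iff'] at hc ⊢
    intro ε hε
    obtain ⟨N, hN⟩ := hc (ε ^ 2) (by positivity)
    refine ⟨N, fun n hn => ?_⟩
    have h1 := hsq N (v n) (hanti N n hn (hvK n))
    have h2 := (abs_lt.1 (hN n hn)).2
    rw [dist_eq_norm]
    exact lt_of_pow_lt_pow_left₀ 2 hε.le (h1.trans_lt h2)
  obtain ⟨l, hl⟩ := cauchySeq_tendsto_of_complete hcau
  have happ : ∀ N : ℕ, ∃ p, IsTailWeights N p ∧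
      dist (∑ j ∈ p.support, p j • h j) (v N) < 1 / ((N : ℝ) + 1) := fun N => by
    obtain ⟨y, hy, hd⟩ := Metric.mem_closure_iff.1 (hvK N) (1 / ((N : ℝ) + 1)) (by positivity)
    obtain ⟨p, hp, rfl⟩ := exists_tailWeights_of_mem_convexHull hy
    exact ⟨p, hp, by rwa [dist_comm]⟩
  choose p hp hpd using happ
  refine ⟨p, hp, l, ?_⟩
  have hd : Tendsto (fun N => dist (∑ j ∈ (p N).support, p N j • h j) (v N)) atTop (𝓝 0) :=
    squeeze_zero (fun _ => dist_nonneg) (fun N => (hpd N).le) tendsto_one_div_add_atTop_nhds_zero_nat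
  exact (tendsto_iff_of_dist hd).2 hl

/-- A sequence bounded in `L²(μ; F)`, with `F` finite-dimensional, has tail convex combinations
that converge in `L²` and almost everywhere. -/
theorem exists_tail_combination_tendsto_ae {α : Type*} [MeasurableSpace α] {μ : Measure α}
    {F : Type*} [NormedAddCommGroup F] [NormedSpace ℝ F] [FiniteDimensional ℝ F]
    {f : ℕ → α → F} (hf : ∀ k, MemLp (f k) 2 μ) {R : ℝ≥0} (hR : ∀ k, eLpNorm (f k) 2 μ ≤ R) :
    ∃ p : ℕ → ℕ →₀ ℝ, (∀ N, IsTailWeights N (p N)) ∧ ∃ v : α → F, MemLp v 2 μ ∧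
      Tendsto (fun N => eLpNorm ((fun t => ∑ j ∈ (p N).support, p N j • f j t) - v) 2 μ)
        atTop (𝓝 0) ∧
      ∀ᵐ t ∂μ, Tendsto (fun N => ∑ j ∈ (p N).support, p N j • f j t) atTop (𝓝 (v t)) := by
  -- `F` carries no inner product, so the Hilbert space argument runs in an isomorphic Euclidean
  -- space.
  set e := toEuclidean (E := F)
  have hg : ∀ k, MemLp (fun t => e (f k t)) 2 μ := fun k =>
    e.toContinuousLinearMap.comp_memLp' (hf k)
  have hgR : ∀ k, ‖(hg k).toLp‖ ≤ ‖e.toContinuousLinearMap‖ * R := fun k => by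
    rw [Lp.norm_toLp]
    refine ENNReal.toReal_le_of_le_ofReal (by positivity) ?_
    refine (eLpNorm_le_mul_eLpNorm_of_ae_le_mul (.of_forall fun t =>
      e.toContinuousLinearMap.le_opNorm (f k t)) 2).trans ?_
    rw [ENNReal.ofReal_mul (norm_nonneg _), ENNReal.ofReal_coe_nnreal]
    gcongr
    exact hR k
  obtain ⟨p, hp, l, hl⟩ := exists_tendsto_tail_combination hgR
  have hsum : ∀ N, ⇑(∑ j ∈ (p N).support, p N j • (hg j).toLp) =ᵐ[μ]
      fun t => ∑ j ∈ (p N).support, p N j • e (f j t) := fun N => by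
    refine (Lp.coeFn_finsetSum _ _).trans ?_
    have : ∀ j, ⇑(p N j • (hg j).toLp) =ᵐ[μ] fun t => p N j • e (f j t) := fun j => by
      filter_upwards [Lp.coeFn_smul (p N j) (hg j).toLp, (hg j).coeFn_toLp] with t h1 h2
      rw [h1, Pi.smul_apply, h2]
    filter_upwards [ae_all_iff.2 this] with t ht
    simp [ht]
  set v : α → F := fun t => e.symm (l t) with hvdef
  have hv : MemLp v 2 μ := e.symm.toContinuousLinearMap.comp_memLp' (Lp.memLp l)
  have hL2 : Tendsto (fun N => eLpNorm ((fun t => ∑ j ∈ (p N).support, p N j • f j t) - v) 2 μ)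
      atTop (𝓝 0) := by
    have h0 := (Lp.tendsto_Lp_iff_tendsto_eLpNorm' _ _).1 hl
    have h1 := ENNReal.Tendsto.const_mul (a := ENNReal.ofReal ‖e.symm.toContinuousLinearMap‖) h0
      (Or.inr ENNReal.ofReal_ne_top)
    rw [mul_zero] at h1
    refine tendsto_of_tendsto_of_tendsto_of_le_of_le tendsto_const_nhds h1 (fun _ => zero_le)
      fun N => ?_
    refine eLpNorm_le_mul_eLpNorm_of_ae_le_mul ?_ 2
    filter_upwards [hsum N] with t ht
    have : ((fun t => ∑ j ∈ (p N).support, p N j • f j t) - v) t = e.symm.toContinuousLinearMap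
        ((⇑(∑ j ∈ (p N).support, p N j • (hg j).toLp) - ⇑l) t) := by
      simp only [Pi.sub_apply, ht, map_sub, map_sum, map_smul, hvdef]
      simp
    rw [this]
    exact ContinuousLinearMap.le_opNorm _ _
  have hmeas : ∀ N, AEStronglyMeasurable (fun t => ∑ j ∈ (p N).support, p N j • f j t) μ :=
    fun N => Finset.aestronglyMeasurable_fun_sum _ fun j _ => (hf j).1.const_smul _
  -- Passing to a subsequence of the combinations is harmless: `N ≤ ns N`, so a combination of the
  -- tail from `ns N` is also one of the tail from `N`.
  obtain ⟨ns, hns, hae⟩ :=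
    (tendstoInMeasure_of_tendsto_eLpNorm (by simp) hmeas hv.1 hL2).exists_seq_tendsto_ae
  exact ⟨fun N => p (ns N), fun N => (hp (ns N)).mono (hns.id_le N), v, hv,
    hL2.comp hns.tendsto_atTop, hae⟩

/-! ### Measurable selection of zeros -/

/-- The set of parameters for which a Carathéodory function has a zero in a compact set is
measurable. -/
theorem measurableSet_exists_zero {Ω X : Type*} [MeasurableSpace Ω] [MetricSpace X] {S : Set X}
    (hS : IsCompact S) {h : Ω → X → ℝ} (hm : ∀ c ∈ S, Measurable fun ω => h ω c)
    (hc : ∀ ω, ContinuousOn (h ω) S) (h0 : ∀ ω, ∀ c ∈ S, 0 ≤ h ω c) :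
    MeasurableSet {ω | ∃ c ∈ S, h ω c = 0} := by
  have : CompactSpace S := isCompact_iff_compactSpace.1 hS
  obtain ⟨D, hDc, hD⟩ := TopologicalSpace.exists_countable_dense S
  -- By compactness the infimum over `S` is attained, and by continuity it may be computed on a
  -- countable dense set.
  have heq : {ω | ∃ c ∈ S, h ω c = 0} = ⋂ n : ℕ, ⋃ c ∈ D, {ω | h ω (c : X) < 1 / ((n : ℝ) + 1)} := by
    ext ω
    simp only [mem_ofPred_eq, mem_iInter, mem_iUnion, exists_prop]
    have hc' : Continuous fun c : S => h ω c := continuousOn_iff_continuous_domRestrict.1 (hc ω)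
    constructor
    · rintro ⟨c, hcS, hz⟩ n
      obtain ⟨x, hx, hxD⟩ := hD.inter_open_nonempty {x : S | h ω x < 1 / ((n : ℝ) + 1)}
        (isOpen_lt hc' continuous_const) ⟨⟨c, hcS⟩, by simp only [mem_ofPred_eq, hz]; positivity⟩
      exact ⟨x, hxD, hx⟩
    · intro H
      obtain ⟨x₀, -, -⟩ := H 0
      obtain ⟨c, hcS, hmin⟩ := hS.exists_isMinOn ⟨x₀, x₀.2⟩ (hc ω)
      refine ⟨c, hcS, le_antisymm (le_of_forall_pos_lt_add fun ε hε => ?_) (h0 ω c hcS)⟩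
      obtain ⟨n, hn⟩ := exists_nat_one_div_lt hε
      obtain ⟨x, -, hx⟩ := H n
      have := isMinOn_iff.1 hmin x x.2
      linarith
  rw [heq]
  exact .iInter fun n => .biUnion hDc fun c _ => measurableSet_lt (hm c c.2) measurable_const

/-- Measurable selection of zeros in a compact subset of the line. -/
theorem exists_measurable_zero_of_real {Ω : Type*} [MeasurableSpace Ω] {S : Set ℝ}
    (hS : IsCompact S) {h : Ω → ℝ → ℝ} (hm : ∀ c ∈ S, Measurable fun ω => h ω c)
    (hc : ∀ ω, ContinuousOn (h ω) S) (h0 : ∀ ω, ∀ c ∈ S, 0 ≤ h ω c)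
    (hz : ∀ ω, ∃ c ∈ S, h ω c = 0) :
    ∃ u : Ω → ℝ, Measurable u ∧ ∀ ω, u ω ∈ S ∧ h ω (u ω) = 0 := by
  have hcl : ∀ ω, IsCompact {c | c ∈ S ∧ h ω c = 0} := fun ω => by
    have : {c | c ∈ S ∧ h ω c = 0} = S ∩ h ω ⁻¹' {0} := rfl
    rw [this]
    exact hS.of_isClosed_subset ((hc ω).preimage_isClosed_of_isClosed hS.isClosed isClosed_singleton)
      inter_subset_left
  have hleast := fun ω => (hcl ω).isLeast_sInf (hz ω)
  refine ⟨fun ω => sInf {c | c ∈ S ∧ h ω c = 0}, measurable_of_Iic fun r => ?_,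
    fun ω => (hleast ω).1⟩
  -- The least zero is at most `r` exactly when there is a zero in the compact set `S ∩ Iic r`.
  have heq : (fun ω => sInf {c | c ∈ S ∧ h ω c = 0}) ⁻¹' Iic r =
      {ω | ∃ c ∈ S ∩ Iic r, h ω c = 0} := by
    ext ω
    simp only [mem_preimage, mem_Iic, mem_ofPred_eq]
    refine ⟨fun hr => ⟨_, ⟨(hleast ω).1.1, hr⟩, (hleast ω).1.2⟩, ?_⟩
    rintro ⟨c, ⟨hcS, hcr⟩, hz⟩
    exact ((hleast ω).2 ⟨hcS, hz⟩).trans hcr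
  rw [heq]
  exact measurableSet_exists_zero (hS.inter_right isClosed_Iic) (fun c hc => hm c hc.1)
    (fun ω => (hc ω).mono inter_subset_left) fun ω c hc => h0 ω c hc.1

/-- Measurable selection of zeros of a Carathéodory function in a compact set. -/
theorem exists_measurable_zero {Ω X : Type*} [MeasurableSpace Ω] {μ : Measure Ω} [MetricSpace X]
    [MeasurableSpace X] [BorelSpace X] {S : Set X} (hS : IsCompact S) (hne : S.Nonempty)
    {h : Ω → X → ℝ} (hm : ∀ c ∈ S, Measurable fun ω => h ω c)
    (hc : ∀ ω, ContinuousOn (h ω) S) (h0 : ∀ ω, ∀ c ∈ S, 0 ≤ h ω c)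
    (hz : ∀ᵐ ω ∂μ, ∃ c ∈ S, h ω c = 0) :
    ∃ u : Ω → X, Measurable u ∧ (∀ ω, u ω ∈ S) ∧ ∀ᵐ ω ∂μ, h ω (u ω) = 0 := by
  classical
  have : CompactSpace S := isCompact_iff_compactSpace.1 hS
  have : Nonempty S := hne.to_subtype
  -- A compact metric space is a continuous image of the Cantor set, which lies on the line; there
  -- the least zero can be selected.
  obtain ⟨f, hf, hfs⟩ := exists_nat_bool_continuous_surjective_of_compact S
  set σ : cantorSet → S := f ∘ cantorSetHomeomorphNatToBool with hσ
  have hσc : Continuous σ := hf.comp (Homeomorph.continuous _)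
  have hσs : Function.Surjective σ := hfs.comp (Homeomorph.surjective _)
  set Z := {ω | ∃ c ∈ S, h ω c = 0}
  have hZ : MeasurableSet Z := measurableSet_exists_zero hS hm hc h0
  -- For parameters outside `Z` the function is made zero on the Cantor set, so that a zero exists
  -- for every `ω`.
  set H : Ω → ℝ → ℝ := fun ω r => if hr : r ∈ cantorSet then
    (if ω ∈ Z then h ω (σ ⟨r, hr⟩) else 0) else 0 with hH
  obtain ⟨u, hu, huS⟩ := exists_measurable_zero_of_real (h := H) isCompact_cantorSet
    (fun c hcC => by
      simp only [hH, dif_pos hcC]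
      exact Measurable.ite hZ (hm _ (σ ⟨c, hcC⟩).2) measurable_const)
    (fun ω => by
      rw [continuousOn_iff_continuous_domRestrict]
      have : cantorSet.domRestrict (H ω) = fun r => if ω ∈ Z then h ω (σ r) else 0 := by
        ext r; simp only [domRestrict_apply, hH, dif_pos r.2]
      rw [this]
      by_cases hω : ω ∈ Z
      · simp only [hω, if_true]
        exact (continuousOn_iff_continuous_domRestrict.1 (hc ω)).comp hσc
      · simp only [hω, if_false]; exact continuous_const)
    (fun ω c hcC => by
      simp only [hH, dif_pos hcC]
      split_ifs
      exacts [h0 _ _ (σ ⟨c, hcC⟩).2, le_rfl])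
    (fun ω => by
      by_cases hω : ω ∈ Z
      · obtain ⟨c, hcS, hcz⟩ := hω
        obtain ⟨r, hr⟩ := hσs ⟨c, hcS⟩
        exact ⟨r, r.2, by simp [hH, hr, hcz]⟩
      · exact ⟨0, zero_mem_cantorSet, by simp [hH, hω]⟩)
  refine ⟨fun ω => σ ⟨u ω, (huS ω).1⟩, ?_, fun ω => (σ _).2, ?_⟩
  · exact measurable_subtype_coe.comp (hσc.measurable.comp (hu.subtype_mk))
  · filter_upwards [hz] with ω hω
    have := (huS ω).2
    have hωZ : ω ∈ Z := hω
    simpa only [hH, dif_pos (huS ω).1, if_pos hωZ] using this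

namespace Sweeping

/-! ### Functions of class `W^{1,2}` -/

instance (T : ℝ) : IsFiniteMeasure (leb T) := by unfold leb; infer_instance

theorem ae_leb_mem (T : ℝ) : ∀ᵐ t ∂(leb T), t ∈ Icc 0 T := ae_restrict_mem measurableSet_Icc

/-- Functions are prescribed on `[0, T]` only, so `deriv` can be identified only at interior times.
-/
theorem ae_leb_mem_Ioo (T : ℝ) : ∀ᵐ t ∂(leb T), t ∈ Ioo 0 T := by
  unfold leb
  rw [← restrict_Ioo_eq_restrict_Icc]
  exact ae_restrict_mem measurableSet_Ioo

section

variable {F G : Type*} [NormedAddCommGroup F] [NormedSpace ℝ F] [NormedAddCommGroup G]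
  [NormedSpace ℝ G] {T : ℝ} {f v : ℝ → F}

theorem integrableOn_of_memLp {F : Type*} [NormedAddCommGroup F] {v : ℝ → F} (hv : MemLp v 2 (leb T)) : IntegrableOn v (Icc 0 T) :=
  hv.integrable (by norm_num)

theorem intervalIntegrable_of_memLp {F : Type*} [NormedAddCommGroup F] {v : ℝ → F} (hv : MemLp v 2 (leb T)) {s t : ℝ} (hs : s ∈ Icc 0 T)
    (ht : t ∈ Icc 0 T) : IntervalIntegrable v volume s t :=
  ((integrableOn_of_memLp hv).mono_set (uIcc_subset_Icc hs ht)).intervalIntegrable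

theorem ae_hasDerivAt_of_eq_integral [CompleteSpace F] (hT : 0 < T) (hv : MemLp v 2 (leb T))
    (hf : ∀ t ∈ Icc (0 : ℝ) T, f t = f 0 + ∫ s in (0 : ℝ)..t, v s) :
    ∀ᵐ t ∂(leb T), HasDerivAt f (v t) t := by
  have h0 : (0 : ℝ) ∈ Icc 0 T := ⟨le_rfl, hT.le⟩
  have hint := (intervalIntegrable_of_memLp hv h0 ⟨hT.le, le_rfl⟩).ae_hasDerivAt_integral
  rw [uIcc_of_le hT.le] at hint
  filter_upwards [ae_leb_mem_Ioo T, ae_restrict_of_ae (s := Icc 0 T) hint] with t ht hd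
  refine ((hd (Ioo_subset_Icc_self ht) 0 h0).const_add (f 0)).congr_of_eventuallyEq ?_
  filter_upwards [Ioo_mem_nhds ht.1 ht.2] with s hs using hf s (Ioo_subset_Icc_self hs)

theorem integral_congr_leb {w : ℝ → F} (h : v =ᵐ[leb T] w) {t : ℝ} (ht : t ∈ Icc 0 T) :
    ∫ s in (0 : ℝ)..t, v s = ∫ s in (0 : ℝ)..t, w s := by
  refine intervalIntegral.integral_congr_ae ?_
  filter_upwards [(ae_restrict_iff' measurableSet_Icc).1 h] with s hs hs'
  rw [uIoc_of_le ht.1] at hs'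
  exact hs ⟨hs'.1.le, hs'.2.trans ht.2⟩

theorem IsW12.ae_hasDerivAt [CompleteSpace F] (hT : 0 < T) (hf : IsW12 T f) :
    ∀ᵐ t ∂(leb T), HasDerivAt f (deriv f t) t := by
  obtain ⟨v, hv, hfv⟩ := hf
  filter_upwards [ae_hasDerivAt_of_eq_integral hT hv hfv] with t ht
  rwa [ht.deriv]

/-- The derivative of a `W^{1,2}` function is any function that it is the integral of. -/
theorem deriv_ae_eq [CompleteSpace F] (hT : 0 < T) (hv : MemLp v 2 (leb T))
    (hf : ∀ t ∈ Icc (0 : ℝ) T, f t = f 0 + ∫ s in (0 : ℝ)..t, v s) : deriv f =ᵐ[leb T] v := by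
  filter_upwards [ae_hasDerivAt_of_eq_integral hT hv hf] with t ht using ht.deriv

theorem IsW12.memLp_deriv [CompleteSpace F] (hT : 0 < T) (hf : IsW12 T f) :
    MemLp (deriv f) 2 (leb T) := by
  obtain ⟨v, hv, hfv⟩ := hf
  exact hv.ae_eq (deriv_ae_eq hT hv hfv).symm

theorem IsW12.eq_integral_deriv [CompleteSpace F] (hT : 0 < T) (hf : IsW12 T f) :
    ∀ t ∈ Icc (0 : ℝ) T, f t = f 0 + ∫ s in (0 : ℝ)..t, deriv f s := by
  obtain ⟨v, hv, hfv⟩ := hf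
  intro t ht
  rw [hfv t ht, integral_congr_leb (deriv_ae_eq hT hv hfv) ht]

theorem IsW12.prodMk [CompleteSpace F] [CompleteSpace G] {g : ℝ → G} (hf : IsW12 T f)
    (hg : IsW12 T g) : IsW12 T fun t => (f t, g t) := by
  obtain ⟨v, hv, hfv⟩ := hf
  obtain ⟨w, hw, hgw⟩ := hg
  refine ⟨fun t => (v t, w t), .of_fst_snd ⟨hv, hw⟩, fun t ht => ?_⟩
  have hi := intervalIntegrable_of_memLp (.of_fst_snd ⟨hv, hw⟩ : MemLp (fun t => (v t, w t)) 2 _)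
    ⟨le_rfl, ht.1.trans ht.2⟩ ht
  refine Prod.ext ?_ ?_
  · refine (hfv t ht).trans ?_
    exact congrArg (f 0 + ·) ((ContinuousLinearMap.fst ℝ F G).intervalIntegral_comp_comm hi)
  · refine (hgw t ht).trans ?_
    exact congrArg (g 0 + ·) ((ContinuousLinearMap.snd ℝ F G).intervalIntegral_comp_comm hi)

theorem IsW12.pi [CompleteSpace F] {ι : Type*} [Fintype ι] {f : ι → ℝ → F}
    (hf : ∀ i, IsW12 T (f i)) : IsW12 T fun t i => f i t := by
  choose v hv hfv using hf
  refine ⟨fun t i => v i t, .of_eval hv, fun t ht => ?_⟩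
  have hi := intervalIntegrable_of_memLp (.of_eval hv : MemLp (fun t i => v i t) 2 _)
    ⟨le_rfl, ht.1.trans ht.2⟩ ht
  ext1 i
  refine (hfv i t ht).trans ?_
  exact congrArg (f i 0 + ·)
    ((ContinuousLinearMap.proj (R := ℝ) (φ := fun _ : ι => F) i).intervalIntegral_comp_comm hi)

theorem IsW12.clm_comp [CompleteSpace F] [CompleteSpace G] (L : F →L[ℝ] G) (hf : IsW12 T f) :
    IsW12 T fun t => L (f t) := by
  obtain ⟨v, hv, hfv⟩ := hf
  refine ⟨fun t => L (v t), L.comp_memLp' hv, fun t ht => ?_⟩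
  beta_reduce
  rw [hfv t ht, map_add, L.intervalIntegral_comp_comm
    (intervalIntegrable_of_memLp hv ⟨le_rfl, ht.1.trans ht.2⟩ ht)]

/-- Hölder continuity of `W^{1,2}` functions. -/
theorem norm_sub_le_of_eq_integral (hv : MemLp v 2 (leb T))
    (hf : ∀ t ∈ Icc (0 : ℝ) T, f t = f 0 + ∫ s in (0 : ℝ)..t, v s) {R : ℝ≥0}
    (hR : eLpNorm v 2 (leb T) ≤ R) {s t : ℝ} (hs : s ∈ Icc 0 T) (ht : t ∈ Icc 0 T) :
    ‖f t - f s‖ ≤ R * √|t - s| := by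
  wlog hst : s ≤ t generalizing s t
  · rw [norm_sub_rev, abs_sub_comm]; exact this ht hs (le_of_not_ge hst)
  have h0 : (0 : ℝ) ∈ Icc 0 T := ⟨le_rfl, hs.1.trans hs.2⟩
  have hle : volume.restrict (Ioc s t) ≤ leb T :=
    Measure.restrict_mono (Ioc_subset_Icc_self.trans (Icc_subset_Icc hs.1 ht.2)) le_rfl
  have heq : f t - f s = ∫ r in Ioc s t, v r := by
    rw [hf t ht, hf s hs, add_sub_add_left_eq_sub, intervalIntegral.integral_interval_sub_left
      (intervalIntegrable_of_memLp hv h0 ht) (intervalIntegrable_of_memLp hv h0 hs),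
      intervalIntegral.integral_of_le hst]
  have key : ‖f t - f s‖ₑ ≤ ENNReal.ofReal (R * √|t - s|) := by
    calc ‖f t - f s‖ₑ ≤ ∫⁻ r in Ioc s t, ‖v r‖ₑ := by
          rw [heq]; exact enorm_integral_le_lintegral_enorm _
      _ = eLpNorm v 1 (volume.restrict (Ioc s t)) := eLpNorm_one_eq_lintegral_enorm.symm
      _ ≤ eLpNorm v 2 (volume.restrict (Ioc s t)) *
          (volume.restrict (Ioc s t)) univ ^ (1 / (1 : ℝ≥0∞).toReal - 1 / (2 : ℝ≥0∞).toReal) :=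
          eLpNorm_le_eLpNorm_mul_rpow_measure_univ (by norm_num) (hv.1.mono_measure hle)
      _ ≤ R * ENNReal.ofReal √|t - s| := by
          gcongr
          · exact (eLpNorm_mono_measure v hle).trans hR
          · rw [Measure.restrict_apply_univ, Real.volume_Ioc, abs_of_nonneg (sub_nonneg.2 hst),
              Real.sqrt_eq_rpow, ENNReal.ofReal_rpow_of_nonneg (sub_nonneg.2 hst) (by norm_num)]
            norm_num
      _ = ENNReal.ofReal (R * √|t - s|) := by
          rw [ENNReal.ofReal_mul R.coe_nonneg, ENNReal.ofReal_coe_nnreal]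
  rw [← ofReal_norm] at key
  exact (ENNReal.ofReal_le_ofReal_iff (by positivity)).1 key

/-- Functions with common initial value and a common modulus of Hölder continuity have a uniformly
convergent subsequence. -/
theorem exists_subseq_tendstoUniformlyOn [FiniteDimensional ℝ F] (hT : 0 ≤ T) {f : ℕ → ℝ → F}
    {y : F} (h0 : ∀ k, f k 0 = y) {R : ℝ}
    (hR : ∀ k, ∀ s ∈ Icc 0 T, ∀ t ∈ Icc 0 T, ‖f k t - f k s‖ ≤ R * √|t - s|) :
    ∃ φ : ℕ → ℕ, StrictMono φ ∧ ∃ g : ℝ → F,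
      TendstoUniformlyOn (fun k => f (φ k)) g atTop (Icc 0 T) := by
  have hmod : Tendsto (fun r : ℝ => R * √|r|) (𝓝 0) (𝓝 0) := by
    have : Continuous fun r : ℝ => R * √|r| := by fun_prop
    simpa using this.tendsto 0
  have hd : ∀ k (s t : Icc (0 : ℝ) T), dist (f k s) (f k t) ≤ R * √|dist s t| := fun k s t => by
    rw [abs_of_nonneg dist_nonneg, Subtype.dist_eq, Real.dist_eq, dist_eq_norm]
    exact hR k t t.2 s s.2
  have heq := Metric.equicontinuous_of_continuity_modulus _ hmod
    (fun k (t : Icc (0 : ℝ) T) => f k t) fun s t k => hd k s t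
  set B : ℕ → BoundedContinuousFunction (Icc (0 : ℝ) T) F := fun k =>
    .mkOfCompact ⟨fun t => f k t, heq.continuous k⟩
  have hB : IsCompact (closure (range B)) := by
    refine BoundedContinuousFunction.arzela_ascoli (Metric.closedBall y (R * √|T|))
      (ProperSpace.isCompact_closedBall _ _) _ ?_ ?_
    · rintro _ t ⟨k, rfl⟩
      have h := hR k 0 ⟨le_rfl, hT⟩ t t.2
      rw [Metric.mem_closedBall, dist_eq_norm]
      change ‖f k t - y‖ ≤ _
      rw [← h0 k]
      refine h.trans ?_
      by_cases hR0 : 0 ≤ R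
      · gcongr 1
        refine Real.sqrt_le_sqrt ?_
        rw [sub_zero, abs_of_nonneg t.2.1, abs_of_nonneg hT]
        exact t.2.2
      · have hT' := (norm_nonneg _).trans (hR 0 0 ⟨le_rfl, hT⟩ T ⟨hT, le_rfl⟩)
        rw [sub_zero] at hT'
        nlinarith [Real.sqrt_nonneg |(t : ℝ) - 0|, Real.sqrt_nonneg |T|, not_le.1 hR0]
    · refine Metric.equicontinuous_of_continuity_modulus _ hmod _ ?_
      rintro s t ⟨_, k, rfl⟩
      exact hd k s t
  obtain ⟨g, -, φ, hφ, hg⟩ := hB.tendsto_subseq fun k => subset_closure (mem_range_self (f := B) k)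
  refine ⟨φ, hφ, fun t => g (projIcc 0 T hT t), ?_⟩
  rw [BoundedContinuousFunction.tendsto_iff_tendstoUniformly] at hg
  rw [tendstoUniformlyOn_iff_tendstoUniformly_comp_coe]
  intro u hu
  filter_upwards [hg u hu] with k hk t
  change (g (projIcc 0 T hT t), B (φ k) t) ∈ u
  rw [projIcc_val]
  exact hk t

end

/-! ### Quadruples as curves in the state space -/

namespace Quadruple

variable {n m d : ℕ} {T : ℝ} {q : Quadruple n m d}

theorem isW12_pos (hx : IsW12 T q.x) (ha : ∀ i, IsW12 T (q.a i)) (hb : ∀ i, IsW12 T (q.b i)) :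
    IsW12 T q.pos := hx.prodMk ((IsW12.pi ha).prodMk (IsW12.pi hb))

theorem deriv_pos_ae_eq (hT : 0 < T) (hx : IsW12 T q.x) (ha : ∀ i, IsW12 T (q.a i))
    (hb : ∀ i, IsW12 T (q.b i)) : deriv q.pos =ᵐ[leb T] q.vel := by
  filter_upwards [hx.ae_hasDerivAt hT, ae_all_iff.2 fun i => (ha i).ae_hasDerivAt hT,
    ae_all_iff.2 fun i => (hb i).ae_hasDerivAt hT] with t h1 h2 h3
  exact (h1.prodMk ((hasDerivAt_pi.2 h2).prodMk (hasDerivAt_pi.2 h3))).deriv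

theorem norm_state_le (w : State n m) :
    ‖w‖ ≤ ‖w.1‖ + (∑ i, ‖w.2.1 i‖ + ∑ i, ‖w.2.2 i‖) := by
  obtain ⟨x, a, b⟩ := w
  have ha : ‖a‖ ≤ ∑ i, ‖a i‖ := (pi_norm_le_iff_of_nonneg (by positivity)).2 fun i =>
    Finset.single_le_sum (f := fun i => ‖a i‖) (fun _ _ => norm_nonneg _) (Finset.mem_univ i)
  have hb : ‖b‖ ≤ ∑ i, ‖b i‖ := (pi_norm_le_iff_of_nonneg (by positivity)).2 fun i =>
    Finset.single_le_sum (f := fun i => ‖b i‖) (fun _ _ => norm_nonneg _) (Finset.mem_univ i)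
  have := norm_nonneg x
  have := norm_nonneg a
  have := norm_nonneg b
  simp only [Prod.norm_mk, sup_le_iff]
  exact ⟨by linarith, by linarith, by linarith⟩

/-- The factor `1 + 2 * m` counts the components: one `x`, and `m` each of `a i` and `b i`. -/
theorem eLpNorm_vel_le (hT : 0 < T) (hx : IsW12 T q.x) (ha : ∀ i, IsW12 T (q.a i))
    (hb : ∀ i, IsW12 T (q.b i)) {R : ℝ≥0} (hxR : w12Norm T q.x ≤ R)
    (haR : ∀ i, w12Norm T (q.a i) ≤ R) (hbR : ∀ i, w12Norm T (q.b i) ≤ R) :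
    eLpNorm q.vel 2 (leb T) ≤ ((1 + 2 * m) * R : ℝ≥0) := by
  have h1 := (hx.memLp_deriv hT).1.norm
  have h2 := fun i => ((ha i).memLp_deriv hT).1.norm
  have h3 := fun i => ((hb i).memLp_deriv hT).1.norm
  have hle : ∀ t, ‖q.vel t‖ ≤
      ‖((fun t => ‖deriv q.x t‖) + ((∑ i, fun t => ‖deriv (q.a i) t‖) +
        ∑ i, fun t => ‖deriv (q.b i) t‖)) t‖ := fun t => by
    refine (norm_state_le _).trans (le_trans (le_of_eq ?_) (le_abs_self _))
    simp only [Pi.add_apply, Finset.sum_apply, vel]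
  have hd : ∀ {F : Type} [NormedAddCommGroup F] [NormedSpace ℝ F] {f : ℝ → F},
      w12Norm T f ≤ R → eLpNorm (fun t => ‖deriv f t‖) 2 (leb T) ≤ R := fun h => by
    rw [eLpNorm_norm]; exact le_add_self.trans h
  calc eLpNorm q.vel 2 (leb T) ≤ _ := eLpNorm_mono hle
    _ ≤ eLpNorm (fun t => ‖deriv q.x t‖) 2 (leb T) +
        (∑ i, eLpNorm (fun t => ‖deriv (q.a i) t‖) 2 (leb T) +
          ∑ i, eLpNorm (fun t => ‖deriv (q.b i) t‖) 2 (leb T)) := by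
      have m2 := Finset.aestronglyMeasurable_sum Finset.univ fun i _ => h2 i
      have m3 := Finset.aestronglyMeasurable_sum Finset.univ fun i _ => h3 i
      refine (eLpNorm_add_le h1 (m2.add m3) (by norm_num)).trans (add_le_add le_rfl ?_)
      exact (eLpNorm_add_le m2 m3 (by norm_num)).trans (add_le_add
        (eLpNorm_sum_le (fun i _ => h2 i) (by norm_num))
        (eLpNorm_sum_le (fun i _ => h3 i) (by norm_num)))
    _ ≤ R + (∑ _i : Fin m, (R : ℝ≥0∞) + ∑ _i : Fin m, (R : ℝ≥0∞)) := by
      gcongr with i _ i _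
      exacts [hd hxR, hd (haR i), hd (hbR i)]
    _ = ((1 + 2 * m) * R : ℝ≥0) := by
      simp only [Finset.sum_const, Finset.card_univ, Fintype.card_fin, nsmul_eq_mul]
      push_cast
      ring

end Quadruple

end Sweeping

/-! ### Lower semicontinuity of integral functionals with convex integrands -/

/-- A lower semicontinuous convex function bounded from below, with values in the extended reals,
lies strictly above affine functions that almost attain its value at a given point. -/
theorem exists_affine_lt_of_convex_epigraph {W : Type*} [NormedAddCommGroup W] [NormedSpace ℝ W]
    {f : W → EReal} (hf : LowerSemicontinuous f)
    (hconv : Convex ℝ {p : W × ℝ | f p.1 ≤ (p.2 : EReal)}) {c : ℝ} (hc : ∀ w, (c : EReal) ≤ f w)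
    {w₀ : W} {β : ℝ} (hβ : (β : EReal) < f w₀) :
    ∃ (A : W →L[ℝ] ℝ) (r : ℝ), (∀ w, ((A w + r : ℝ) : EReal) < f w) ∧ β < A w₀ + r := by
  obtain ⟨β', hββ', hβ'⟩ := EReal.lt_iff_exists_real_btwn.1 hβ
  have hββ : β < β' := EReal.coe_lt_coe_iff.1 hββ'
  set E := {p : W × ℝ | f p.1 ≤ (p.2 : EReal)} with hE
  rcases E.eq_empty_or_nonempty with hemp | ⟨⟨w₁, r₁⟩, h₁⟩
  · refine ⟨0, β', fun w => lt_of_not_ge fun h => ?_, by simpa using hββ⟩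
    have : (w, (0 : W →L[ℝ] ℝ) w + β') ∈ E := h
    rw [hemp] at this
    exact this
  have hcl : IsClosed E := hf.isClosed_epigraph.preimage
    (continuous_fst.prodMk (continuous_coe_real_ereal.comp continuous_snd))
  -- The sign of the vertical coefficient `k` of the separating hyperplane decides: `k < 0`
  -- contradicts the epigraph being unbounded upwards, and `k > 0` gives the minorant after division
  -- by `k`.
  obtain ⟨F, s, hFs, hsF⟩ := geometric_hahn_banach_point_closed hconv hcl
    (x := (w₀, β')) (not_le.2 hβ')
  set p : W →L[ℝ] ℝ := F.comp (ContinuousLinearMap.inl ℝ W ℝ) with hp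
  set k : ℝ := F (0, 1)
  have hF : ∀ w ρ, F (w, ρ) = p w + k * ρ := fun w ρ => by
    have : (w, ρ) = (w, (0 : ℝ)) + ρ • ((0 : W), (1 : ℝ)) := by simp
    rw [this, map_add, map_smul, smul_eq_mul, mul_comm]
    rfl
  have hE' : ∀ w (ρ : ℝ), f w ≤ (ρ : EReal) → s < p w + k * ρ := fun w ρ h => hF w ρ ▸ hsF (w, ρ) h
  rw [hF] at hFs
  rcases lt_trichotomy k 0 with hk | hk | hk
  · exfalso
    have h := hE' w₁ (max r₁ ((s - p w₁) / k))
      (le_trans h₁ (EReal.coe_le_coe_iff.2 (le_max_left _ _)))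
    have h2 := mul_le_mul_of_nonpos_left (le_max_right r₁ ((s - p w₁) / k)) hk.le
    rw [mul_div_cancel₀ _ hk.ne] at h2
    linarith
  -- A vertical hyperplane separates `w₀` from the effective domain. The slope `M` is steep enough
  -- to lift the value at `w₀` above `β`, while on the domain the affine function stays below the
  -- lower bound `c`.
  · simp only [hk, zero_mul, add_zero] at hE' hFs
    have hpos : 0 < s - p w₀ := by linarith
    set M : ℝ := (|β - c| + 1) / (s - p w₀) with hM
    have hM0 : 0 < M := by positivity
    refine ⟨-(M • p), M * s + c, fun w => lt_of_not_ge fun h => ?_, ?_⟩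
    · have h1 := hE' w _ h
      have h2 := EReal.coe_le_coe_iff.1 ((hc w).trans h)
      simp only [neg_apply, smul_apply, smul_eq_mul] at h2
      nlinarith
    · have : M * (s - p w₀) = |β - c| + 1 := div_mul_cancel₀ _ hpos.ne'
      have h3 := le_abs_self (β - c)
      simp only [neg_apply, smul_apply, smul_eq_mul]
      linarith
  · refine ⟨-(k⁻¹ • p), k⁻¹ * s, fun w => lt_of_not_ge fun h => ?_, ?_⟩
    · have h1 := hE' w _ h
      simp only [neg_apply, smul_apply, smul_eq_mul] at h1
      have : k * (-(k⁻¹ * p w) + k⁻¹ * s) = s - p w := by field_simp; ring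
      linarith
    · simp only [neg_apply, smul_apply, smul_eq_mul]
      have : β' < k⁻¹ * (s - p w₀) := by
        rw [inv_mul_eq_div, lt_div_iff₀ hk]; linarith
      linarith

/-- A quadratic perturbation makes a strict affine minorant persist under perturbations of the
parameter. -/
theorem eventually_affine_le {Y W : Type*} [TopologicalSpace Y] [NormedAddCommGroup W]
    [NormedSpace ℝ W] [ProperSpace W] {f : Y × W → EReal} (hf : LowerSemicontinuous f) {c : ℝ}
    (hc : ∀ z, (c : EReal) ≤ f z) {y₀ : Y} {A : W →L[ℝ] ℝ} {r : ℝ}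
    (hA : ∀ w, ((A w + r : ℝ) : EReal) < f (y₀, w)) {ε : ℝ} (hε : 0 < ε) :
    ∀ᶠ y in 𝓝 y₀, ∀ w, ∀ ρ : ℝ, f (y, w) ≤ ρ → A w + r ≤ ρ + ε * ‖w‖ ^ 2 := by
  -- Beyond radius `B` the term `ε * ‖w‖ ^ 2` dominates `A w + r - c`, so the lower bound `c`
  -- suffices; within it, compactness of the ball makes the semicontinuity uniform in `w`.
  set B : ℝ := max 1 ((‖A‖ + |r - c|) / ε)
  have hB : ∀ᶠ y in 𝓝 y₀, ∀ w ∈ Metric.closedBall (0 : W) B,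
      ((A w + r : ℝ) : EReal) < f (y, w) := by
    refine (isCompact_closedBall (0 : W) B).eventually_forall_of_forall_eventually
      (P := fun y w => ((A w + r : ℝ) : EReal) < f (y, w)) fun w _ => ?_
    obtain ⟨ρ, h1, h2⟩ := EReal.lt_iff_exists_real_btwn.1 (hA w)
    have hcont : ContinuousAt (fun z : Y × W => A z.2 + r) (y₀, w) := by fun_prop
    have h3 := hcont.eventually_lt_const (EReal.coe_lt_coe_iff.1 h1)
    filter_upwards [hf (y₀, w) ρ h2, h3] with z hz hz'
    exact (EReal.coe_lt_coe_iff.2 hz').trans hz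
  filter_upwards [hB] with y hy w ρ hρ
  by_cases hw : w ∈ Metric.closedBall (0 : W) B
  · have := EReal.coe_lt_coe_iff.1 ((hy w hw).trans_le hρ)
    have : 0 ≤ ε * ‖w‖ ^ 2 := by positivity
    linarith
  · have hBw : B < ‖w‖ := by simpa using hw
    have h1 : 1 ≤ ‖w‖ := (le_max_left _ _).trans hBw.le
    have h2 : ‖A‖ + |r - c| ≤ ‖w‖ * ε := by
      rw [← div_le_iff₀ hε]; exact (le_max_right _ _).trans hBw.le
    have h3 := EReal.coe_le_coe_iff.1 ((hc (y, w)).trans hρ)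
    have h4 := (le_abs_self _).trans (A.le_opNorm w)
    have h5 := le_abs_self (r - c)
    have h6 := abs_nonneg (r - c)
    nlinarith

/-- The value of a convex integrand at the limit of tail convex combinations of the velocities is
asymptotically below the combinations of its values, up to a quadratic perturbation. -/
theorem eventually_lt_tail_combination {Y W : Type*} [TopologicalSpace Y] [NormedAddCommGroup W]
    [NormedSpace ℝ W] [ProperSpace W] {f : Y × W → EReal} (hf : LowerSemicontinuous f) {c : ℝ}
    (hc : ∀ z, (c : EReal) ≤ f z) {y : ℕ → Y} {y₀ : Y} (hy : Tendsto y atTop (𝓝 y₀))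
    (hconv : Convex ℝ {p : W × ℝ | f (y₀, p.1) ≤ (p.2 : EReal)})
    {p : ℕ → ℕ →₀ ℝ} (hp : ∀ N, IsTailWeights N (p N)) {w : ℕ → W} {w₀ : W}
    (hw : Tendsto (fun N => ∑ j ∈ (p N).support, p N j • w j) atTop (𝓝 w₀)) {l : ℕ → ℝ}
    (hl : ∀ j, f (y j, w j) ≤ l j) {ε : ℝ} (hε : 0 < ε) {β : ℝ} (hβ : (β : EReal) < f (y₀, w₀)) :
    ∀ᶠ N in atTop, β < ∑ j ∈ (p N).support, p N j * (l j + ε * ‖w j‖ ^ 2) := by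
  obtain ⟨A, r, hA, hAβ⟩ := exists_affine_lt_of_convex_epigraph (f := fun w => f (y₀, w))
    (hf.comp (g := fun w => (y₀, w)) (by fun_prop)) hconv (fun w => hc _) hβ
  obtain ⟨J, hJ⟩ := eventually_atTop.1 (hy.eventually (eventually_affine_le hf hc hA hε))
  have hcont : Tendsto (fun N => A (∑ j ∈ (p N).support, p N j • w j) + r) atTop
      (𝓝 (A w₀ + r)) := ((A.continuous.tendsto w₀).comp hw).add_const r
  filter_upwards [hcont.eventually_const_lt hAβ, eventually_ge_atTop J] with N hN hJN
  refine hN.trans_le ?_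
  have : A (∑ j ∈ (p N).support, p N j • w j) + r =
      ∑ j ∈ (p N).support, p N j * (A (w j) + r) := by
    simp only [mul_add, Finset.sum_add_distrib, ← Finset.sum_mul, (hp N).sum_eq_one, one_mul,
      map_sum, map_smul, smul_eq_mul]
  rw [this]
  refine Finset.sum_le_sum fun j hj => mul_le_mul_of_nonneg_left ?_ ((hp N).nonneg j)
  exact hJ j (hJN.trans ((hp N).le_of_mem j hj)) (w j) (l j) (hl j)

/-- Lower semicontinuity of the integral of a convex normal integrand along convergent states and
velocities whose tail convex combinations converge. -/
theorem integral_le_of_tail_combination {α Y W : Type*} [MeasurableSpace α] {μ : Measure α}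
    [IsFiniteMeasure μ] [TopologicalSpace Y] [NormedAddCommGroup W] [NormedSpace ℝ W]
    [ProperSpace W] {f : α → Y × W → EReal} (hf : ∀ᵐ t ∂μ, LowerSemicontinuous (f t)) {c : ℝ}
    (hc : ∀ᵐ t ∂μ, ∀ z, (c : EReal) ≤ f t z)
    (hconv : ∀ᵐ t ∂μ, ∀ y, Convex ℝ {p : W × ℝ | f t (y, p.1) ≤ (p.2 : EReal)})
    {y : ℕ → α → Y} {y₀ : α → Y} (hy : ∀ᵐ t ∂μ, Tendsto (fun j => y j t) atTop (𝓝 (y₀ t)))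
    {p : ℕ → ℕ →₀ ℝ} (hp : ∀ N, IsTailWeights N (p N)) {w : ℕ → α → W} {w₀ : α → W}
    (hw : ∀ᵐ t ∂μ, Tendsto (fun N => ∑ j ∈ (p N).support, p N j • w j t) atTop (𝓝 (w₀ t)))
    (hwL : ∀ j, MemLp (w j) 2 μ) {R : ℝ} (hR : ∀ j, ∫ t, ‖w j t‖ ^ 2 ∂μ ≤ R) {l : ℕ → α → ℝ}
    (hl : ∀ j, ∀ᵐ t ∂μ, f t (y j t, w j t) ≤ l j t) (hli : ∀ j, Integrable (l j) μ) {I : ℝ}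
    (hI : Tendsto (fun j => ∫ t, l j t ∂μ) atTop (𝓝 I))
    (hmeas : AEMeasurable (fun t => f t (y₀ t, w₀ t)) μ) :
    (∀ᵐ t ∂μ, f t (y₀ t, w₀ t) ≠ ⊤ ∧ f t (y₀ t, w₀ t) ≠ ⊥) ∧
      Integrable (fun t => (f t (y₀ t, w₀ t)).toReal) μ ∧
      ∫ t, (f t (y₀ t, w₀ t)).toReal ∂μ ≤ I := by
  set m : ℝ := μ.real univ
  -- Subtracting the lower bound `c` makes the integrand nonnegative, as Fatou's lemma requires.
  set G : α → ℝ≥0∞ := fun t => (f t (y₀ t, w₀ t) - (c : EReal)).toENNReal with hG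
  have hGm : AEMeasurable G μ :=
    measurable_ereal_toENNReal.comp_aemeasurable (hmeas.sub_const _)
  have hcl : ∀ j, ∀ᵐ t ∂μ, c ≤ l j t := fun j => by
    filter_upwards [hc, hl j] with t h1 h2 using EReal.coe_le_coe_iff.1 ((h1 _).trans h2)
  have hcI : 0 ≤ I - c * m := by
    refine sub_nonneg.2 (ge_of_tendsto' hI fun j => ?_)
    have := integral_mono_ae (integrable_const c) (hli j) (hcl j)
    rwa [integral_const, smul_eq_mul, mul_comm] at this
  have hsq : ∀ j, Integrable (fun t => ‖w j t‖ ^ 2) μ := fun j => (hwL j).integrable_norm_pow (by simp)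
  have hbound : ∀ ε : ℝ, 0 < ε → ∫⁻ t, G t ∂μ ≤ ENNReal.ofReal (I + ε * R - c * m) := by
    intro ε hε
    have hpi : ∀ N j, Integrable (fun t => p N j * (l j t + ε * ‖w j t‖ ^ 2)) μ := fun N j =>
      ((hli j).add ((hsq j).const_mul ε)).const_mul _
    set ψ : ℕ → α → ℝ := fun N t =>
      (∑ j ∈ (p N).support, p N j * (l j t + ε * ‖w j t‖ ^ 2)) - c with hψ
    have hψi : ∀ N, Integrable (ψ N) μ := fun N =>
      (integrable_finsetSum _ fun j _ => hpi N j).sub (integrable_const c)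
    have hψ0 : ∀ N, 0 ≤ᵐ[μ] ψ N := fun N => by
      filter_upwards [ae_all_iff.2 hcl] with t ht
      refine sub_nonneg.2 ((hp N).le_sum fun j _ => ?_)
      have : 0 ≤ ε * ‖w j t‖ ^ 2 := by positivity
      linarith [ht j]
    have hψI : ∀ N, ∫ t, ψ N t ∂μ ≤
        (∑ j ∈ (p N).support, p N j • ∫ t, l j t ∂μ) + ε * R - c * m := fun N => by
      simp only [hψ]
      rw [integral_sub (integrable_finsetSum _ fun j _ => hpi N j) (integrable_const c),
        integral_finsetSum _ fun j _ => hpi N j, integral_const, smul_eq_mul, mul_comm (μ.real univ)]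
      refine sub_le_sub_right ?_ _
      have h1 : ∀ j, ∫ t, p N j * (l j t + ε * ‖w j t‖ ^ 2) ∂μ =
          p N j * ∫ t, l j t ∂μ + p N j * (ε * ∫ t, ‖w j t‖ ^ 2 ∂μ) := fun j => by
        rw [integral_const_mul, integral_add (hli j) ((hsq j).const_mul ε), integral_const_mul,
          mul_add]
      simp only [h1, Finset.sum_add_distrib, smul_eq_mul]
      exact add_le_add le_rfl ((hp N).sum_le fun j _ => mul_le_mul_of_nonneg_left (hR j) hε.le)
    have hGle : ∀ᵐ t ∂μ, G t ≤ liminf (fun N => ENNReal.ofReal (ψ N t)) atTop := by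
      filter_upwards [hf, hc, hconv, hy, hw, ae_all_iff.2 hl] with t h1 h2 h3 h4 h5 h6
      refine le_of_forall_lt fun b hb => ?_
      obtain ⟨b', hbb', hb'⟩ := exists_between hb
      have hb'top : b' ≠ ⊤ := hb'.ne_top
      have hβ : ((b'.toReal + c : ℝ) : EReal) < f t (y₀ t, w₀ t) := by
        rw [EReal.coe_add]
        refine EReal.add_lt_of_lt_sub ?_
        have h7 : (b' : EReal) < ((f t (y₀ t, w₀ t) - (c : EReal)).toENNReal : EReal) :=
          EReal.coe_ennreal_lt_coe_ennreal_iff.2 hb'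
        rwa [EReal.coe_toENNReal (EReal.sub_nonneg (by simp) (by simp) |>.2 (h2 _)),
          ← EReal.coe_ennreal_toReal hb'top] at h7
      have h8 := eventually_lt_tail_combination h1 h2 h4 (h3 _) hp h5 h6 hε hβ
      refine hbb'.trans_le (le_liminf_of_le (by isBoundedDefault) ?_)
      filter_upwards [h8] with N hN
      rw [← ENNReal.ofReal_toReal hb'top]
      exact ENNReal.ofReal_le_ofReal (by simp only [hψ]; linarith)
    calc ∫⁻ t, G t ∂μ ≤ ∫⁻ t, liminf (fun N => ENNReal.ofReal (ψ N t)) atTop ∂μ :=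
          lintegral_mono_ae hGle
      _ ≤ liminf (fun N => ∫⁻ t, ENNReal.ofReal (ψ N t) ∂μ) atTop :=
          lintegral_liminf_le' fun N => (hψi N).1.aemeasurable.ennreal_ofReal
      _ ≤ liminf (fun N => ENNReal.ofReal
            ((∑ j ∈ (p N).support, p N j • ∫ t, l j t ∂μ) + ε * R - c * m)) atTop := by
          refine liminf_le_liminf (.of_forall fun N => ?_)
          rw [← ofReal_integral_eq_lintegral_ofReal (hψi N) (hψ0 N)]
          exact ENNReal.ofReal_le_ofReal (hψI N)
      _ = ENNReal.ofReal (I + ε * R - c * m) :=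
          (ENNReal.tendsto_ofReal (((tendsto_tail_combination hp hI).add_const _).sub_const
            _)).liminf_eq
  have hGI : ∫⁻ t, G t ∂μ ≤ ENNReal.ofReal (I - c * m) := by
    have hlim : Tendsto (fun ε : ℝ => ENNReal.ofReal (I + ε * R - c * m)) (𝓝[>] 0)
        (𝓝 (ENNReal.ofReal (I - c * m))) := by
      refine ENNReal.tendsto_ofReal (tendsto_nhdsWithin_of_tendsto_nhds ?_)
      have : Continuous fun ε : ℝ => I + ε * R - c * m := by fun_prop
      simpa using this.tendsto 0
    exact ge_of_tendsto hlim (eventually_mem_nhdsWithin.mono fun ε hε => hbound ε hε)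
  have hGtop : ∫⁻ t, G t ∂μ ≠ ⊤ := (hGI.trans_lt ENNReal.ofReal_lt_top).ne
  have hfin : ∀ᵐ t ∂μ, f t (y₀ t, w₀ t) ≠ ⊤ ∧ f t (y₀ t, w₀ t) ≠ ⊥ := by
    filter_upwards [ae_lt_top' hGm hGtop, hc] with t h1 h2
    refine ⟨fun h => ?_, fun h => ?_⟩
    · simp [hG, h] at h1
    · have := h2 (y₀ t, w₀ t)
      simp [h] at this
  have heq : (fun t => (f t (y₀ t, w₀ t)).toReal) =ᵐ[μ] fun t => (G t).toReal + c := by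
    filter_upwards [hfin, hc] with t h1 h2
    have h3 : (0 : EReal) ≤ f t (y₀ t, w₀ t) - c :=
      (EReal.sub_nonneg (by simp) (by simp)).2 (h2 _)
    simp only [hG]
    rw [EReal.toReal_toENNReal h3, EReal.toReal_sub h1.1 h1.2 (by simp) (by simp), EReal.toReal_coe]
    ring
  have hGi : Integrable (fun t => (G t).toReal) μ := integrable_toReal_of_lintegral_ne_top hGm hGtop
  refine ⟨hfin, (hGi.add (integrable_const c)).congr heq.symm, ?_⟩
  rw [integral_congr_ae heq, integral_add hGi (integrable_const c), integral_const, smul_eq_mul,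
    integral_toReal hGm (ae_lt_top' hGm hGtop)]
  have := ENNReal.toReal_le_of_le_ofReal hcI hGI
  change _ + m * c ≤ I
  linarith

/-- Superposition measurability of an integrand continuous in time and lower semicontinuous in the
other variable, at almost every time. -/
theorem aemeasurable_superposition {Z : Type*} [TopologicalSpace Z] [MeasurableSpace Z]
    [OpensMeasurableSpace Z] {μ : Measure ℝ} {S : Set ℝ} (hS : ∀ᵐ t ∂μ, t ∈ S)
    {f : ℝ → Z → EReal} (hf : ∀ᵐ t ∂μ, LowerSemicontinuous (f t))
    (hcont : ∀ᵐ t ∂μ, ∀ z, ContinuousWithinAt (fun s => f s z) S t) {z : ℝ → Z}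
    (hz : AEMeasurable z μ) : AEMeasurable (fun t => f t (z t)) μ := by
  classical
  -- Time is approximated by simple functions with values in the set `G` of good times. At each such
  -- value the integrand is Borel in `z`, and continuity in time gives the pointwise limit; the
  -- default `0` in `F` is never reached.
  set G : Set ℝ := {t | t ∈ S ∧ LowerSemicontinuous (f t) ∧
    ∀ z, ContinuousWithinAt (fun s => f s z) S t}
  have hG : ∀ᵐ t ∂μ, t ∈ G := by
    filter_upwards [hS, hf, hcont] with t h1 h2 h3 using ⟨h1, h2, h3⟩
  rcases G.eq_empty_or_nonempty with hemp | ⟨t₀, ht₀⟩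
  · have : μ = 0 := by
      rw [← ae_eq_bot, ← eventually_false_iff_eq_bot]
      filter_upwards [hG] with t ht
      rwa [hemp] at ht
    rw [this]
    exact aemeasurable_zero_measure
  set F : ℝ → Z → EReal := fun b => if b ∈ G then f b else fun _ => 0 with hF
  have hFm : ∀ b, Measurable (F b) := fun b => by
    by_cases hb : b ∈ G
    · simp only [hF, if_pos hb]; exact hb.2.1.measurable
    · simp only [hF, if_neg hb]; exact measurable_const
  set s := fun n => SimpleFunc.approxOn (id : ℝ → ℝ) measurable_id G t₀ ht₀ n
  have hs : ∀ n t, s n t ∈ G := fun n t => SimpleFunc.approxOn_mem measurable_id ht₀ n t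
  refine AEMeasurable.congr (f := fun t => f t (hz.mk z t)) ?_ ?_
  · refine aemeasurable_of_tendsto_metrizable_ae atTop
      (f := fun n t => F (s n t) (hz.mk z t)) (fun n => Measurable.aemeasurable ?_) ?_
    · exact (s n).measurable_bind (fun b t => F b (hz.mk z t)) fun b =>
        (hFm b).comp hz.measurable_mk
    · filter_upwards [hG] with t ht
      have h1 : Tendsto (fun n => s n t) atTop (𝓝[S] t) :=
        tendsto_nhdsWithin_iff.2 ⟨SimpleFunc.tendsto_approxOn measurable_id ht₀ (subset_closure ht),
          .of_forall fun n => (hs n t).1⟩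
      simpa only [hF, if_pos (hs _ t), Function.comp_def] using (ht.2.2 (hz.mk z t)).tendsto.comp h1
  · filter_upwards [hz.ae_eq_mk] with t ht
    rw [ht]

namespace Sweeping

/-! ### Limits of normals to moving polyhedra -/

/-- Under a Slater condition on the limit polyhedron, limits of tail convex combinations of normals
are normals. -/
theorem mem_normalCone_of_tail_combination {n m : ℕ} {a : ℕ → Fin m → E n} {b : ℕ → Fin m → ℝ}
    {a₀ : Fin m → E n} {b₀ : Fin m → ℝ} (ha : ∀ i, Tendsto (fun j => a j i) atTop (𝓝 (a₀ i)))
    (hb : ∀ i, Tendsto (fun j => b j i) atTop (𝓝 (b₀ i))) {x ζ : ℕ → E n} {x₀ ζ₀ : E n}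
    (hζ : ∀ j, ζ j ∈ normalCone (x j) (polyhedron (a j) (b j)))
    (hx : Tendsto (fun j => ‖ζ j‖ * ‖x j - x₀‖) atTop (𝓝 0)) (hx₀ : x₀ ∈ polyhedron a₀ b₀)
    {p : ℕ → ℕ →₀ ℝ} (hp : ∀ N, IsTailWeights N (p N))
    (hζ₀ : Tendsto (fun N => ∑ j ∈ (p N).support, p N j • ζ j) atTop (𝓝 ζ₀))
    {z : E n} (hz : ∀ i, inner ℝ (a₀ i) z < b₀ i) :
    ζ₀ ∈ normalCone x₀ (polyhedron a₀ b₀) := by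
  have hstrict : ∀ y : E n, (∀ i, inner ℝ (a₀ i) y < b₀ i) → inner ℝ ζ₀ (y - x₀) ≤ 0 := by
    intro y hy
    have hev : ∀ᶠ j in atTop, y ∈ polyhedron (a j) (b j) := by
      refine eventually_all.2 fun i => ?_
      exact (((ha i).inner tendsto_const_nhds).eventually_lt (hb i) (hy i)).mono fun _ => le_of_lt
    obtain ⟨J, hJ⟩ := eventually_atTop.1 hev
    have hle : ∀ᶠ N in atTop, inner ℝ (∑ j ∈ (p N).support, p N j • ζ j) (y - x₀) ≤
        ∑ j ∈ (p N).support, p N j • (‖ζ j‖ * ‖x j - x₀‖) := by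
      filter_upwards [eventually_ge_atTop J] with N hN
      rw [sum_inner]
      refine Finset.sum_le_sum fun j hj => ?_
      rw [real_inner_smul_left, smul_eq_mul]
      refine mul_le_mul_of_nonneg_left ?_ ((hp N).nonneg j)
      have h1 := (hζ j).2 y (hJ j (hN.trans ((hp N).le_of_mem j hj)))
      have h2 : inner ℝ (ζ j) (y - x₀) = inner ℝ (ζ j) (y - x j) + inner ℝ (ζ j) (x j - x₀) := by
        rw [← inner_add_right, sub_add_sub_cancel]
      linarith [real_inner_le_norm (ζ j) (x j - x₀)]
    exact le_of_tendsto_of_tendsto (hζ₀.inner tendsto_const_nhds) (tendsto_tail_combination hp hx)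
      hle
  refine ⟨hx₀, fun y hy => ?_⟩
  -- A general `y` is approached along the segment towards the Slater point `z`, whose points with
  -- `0 < s < 1` are strictly feasible.
  have hlim : Tendsto (fun s : ℝ => inner ℝ ζ₀ (y + s • (z - y) - x₀)) (𝓝[>] 0)
      (𝓝 (inner ℝ ζ₀ (y - x₀))) := by
    refine tendsto_nhdsWithin_of_tendsto_nhds ?_
    have : Continuous fun s : ℝ => inner ℝ ζ₀ (y + s • (z - y) - x₀) := by fun_prop
    simpa using this.tendsto 0
  refine le_of_tendsto hlim ?_
  filter_upwards [Ioo_mem_nhdsGT (zero_lt_one' ℝ)] with s hs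
  refine hstrict _ fun i => ?_
  have h1 := hy i
  have h2 := hz i
  rw [inner_add_right, real_inner_smul_right, inner_sub_right]
  nlinarith [hs.1, hs.2]

/-! ### Limits of velocity sets -/

section

variable {X V F : Type*} [NormedAddCommGroup X] [NormedAddCommGroup F]
  [NormedSpace ℝ F] {U : Set V} {g : X → V → F} {L : ℝ} {x : ℕ → X} {x₀ : X}

/-- The controls realizing a convex combination at `x k` need not converge: the uniform Lipschitz
bound shows that their images under `g x₀` approach the combination, and the image is closed. -/
theorem convex_image_of_tendsto (hL : ∀ x₁ x₂, ∀ u ∈ U, ‖g x₁ u - g x₂ u‖ ≤ L * ‖x₁ - x₂‖)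
    (hcl : IsClosed (g x₀ '' U)) (hx : Tendsto x atTop (𝓝 x₀))
    (hconv : ∀ k, Convex ℝ (g (x k) '' U)) : Convex ℝ (g x₀ '' U) := by
  rintro _ ⟨u₁, hu₁, rfl⟩ _ ⟨u₂, hu₂, rfl⟩ s t hs ht hst
  have h := fun k => hconv k (mem_image_of_mem _ hu₁) (mem_image_of_mem _ hu₂) hs ht hst
  choose u hu hgu using h
  have hlim : ∀ v ∈ U, Tendsto (fun k => g (x k) v) atTop (𝓝 (g x₀ v)) := fun v hv => by
    rw [tendsto_iff_norm_sub_tendsto_zero] at hx ⊢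
    exact squeeze_zero (fun _ => norm_nonneg _) (fun k => hL _ _ v hv) (by simpa using hx.const_mul L)
  have h1 : Tendsto (fun k => g (x k) (u k)) atTop (𝓝 (s • g x₀ u₁ + t • g x₀ u₂)) := by
    simp only [hgu]
    exact ((hlim u₁ hu₁).const_smul s).add ((hlim u₂ hu₂).const_smul t)
  have h2 : Tendsto (fun k => g x₀ (u k) - g (x k) (u k)) atTop (𝓝 0) := by
    refine squeeze_zero_norm (fun k => hL _ _ _ (hu k)) ?_
    have := (tendsto_iff_norm_sub_tendsto_zero.1 hx).const_mul L
    simpa [norm_sub_rev] using this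
  have h3 := h2.add h1
  simp only [sub_add_cancel, zero_add] at h3
  exact hcl.mem_of_tendsto h3 (.of_forall fun k => mem_image_of_mem _ (hu k))

/-- Replacing `x j` by `x₀` changes the combinations by a vanishing error and places all of them in
one closed convex set. -/
theorem mem_image_of_tail_combination
    (hL : ∀ x₁ x₂, ∀ u ∈ U, ‖g x₁ u - g x₂ u‖ ≤ L * ‖x₁ - x₂‖)
    (hcl : IsClosed (g x₀ '' U)) (hx : Tendsto x atTop (𝓝 x₀))
    (hconv : ∀ k, Convex ℝ (g (x k) '' U)) {p : ℕ → ℕ →₀ ℝ} (hp : ∀ N, IsTailWeights N (p N))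
    {u : ℕ → V} (hu : ∀ k, u k ∈ U) {γ : F}
    (hγ : Tendsto (fun N => ∑ j ∈ (p N).support, p N j • g (x j) (u j)) atTop (𝓝 γ)) :
    γ ∈ g x₀ '' U := by
  have h2 : Tendsto (fun k => g x₀ (u k) - g (x k) (u k)) atTop (𝓝 0) := by
    refine squeeze_zero_norm (fun k => hL _ _ _ (hu k)) ?_
    have := (tendsto_iff_norm_sub_tendsto_zero.1 hx).const_mul L
    simpa [norm_sub_rev] using this
  have h3 := (tendsto_tail_combination hp h2).add hγ
  simp only [smul_sub, Finset.sum_sub_distrib, sub_add_cancel, zero_add] at h3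
  exact hcl.mem_of_tendsto h3 (.of_forall fun N =>
    (hp N).sum_mem (convex_image_of_tendsto hL hcl hx hconv) fun j _ => mem_image_of_mem _ (hu j))

end

/-! ### Integrals of tail convex combinations -/

section

variable {F : Type*} [NormedAddCommGroup F] [NormedSpace ℝ F] {T : ℝ}

theorem IsW12.continuousOn {f : ℝ → F} (hf : IsW12 T f) : ContinuousOn f (Icc 0 T) := by
  obtain ⟨v, hv, hfv⟩ := hf
  rcases lt_or_ge T 0 with hT | hT
  · simp [Icc_eq_empty_of_lt hT]
  have := intervalIntegral.continuousOn_primitive_interval (f := v) (μ := volume) (a := 0) (b := T)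
    (by rw [uIcc_of_le hT]; exact integrableOn_of_memLp hv)
  rw [uIcc_of_le hT] at this
  exact (continuousOn_const.add this).congr hfv

theorem IsW12.aestronglyMeasurable {f : ℝ → F} (hf : IsW12 T f) :
    AEStronglyMeasurable f (leb T) :=
  hf.continuousOn.aestronglyMeasurable_of_isCompact isCompact_Icc measurableSet_Icc

/-- The Hölder estimate, applied to the primitive of the difference, bounds the error by its $L^2$
norm times $\sqrt t$. -/
theorem tendsto_integral_tail_combination {h : ℕ → ℝ → F} (hh : ∀ j, MemLp (h j) 2 (leb T))
    {v : ℝ → F} (hv : MemLp v 2 (leb T)) {p : ℕ → ℕ →₀ ℝ}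
    (hlim : Tendsto (fun N => eLpNorm ((fun t => ∑ j ∈ (p N).support, p N j • h j t) - v) 2 (leb T))
      atTop (𝓝 0)) {t : ℝ} (ht : t ∈ Icc 0 T) :
    Tendsto (fun N => ∑ j ∈ (p N).support, p N j • ∫ s in (0 : ℝ)..t, h j s) atTop
      (𝓝 (∫ s in (0 : ℝ)..t, v s)) := by
  have h0 : (0 : ℝ) ∈ Icc 0 T := ⟨le_rfl, ht.1.trans ht.2⟩
  have hS : ∀ N, MemLp (fun t => ∑ j ∈ (p N).support, p N j • h j t) 2 (leb T) := fun N =>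
    memLp_finsetSum _ fun j _ => (hh j).const_smul _
  rw [tendsto_iff_norm_sub_tendsto_zero]
  have hlim' := ((ENNReal.tendsto_toReal ENNReal.zero_ne_top).comp hlim).mul_const √|t - 0|
  rw [ENNReal.toReal_zero, zero_mul] at hlim'
  refine squeeze_zero (fun _ => norm_nonneg _) (fun N => ?_) hlim'
  have hd := (hS N).sub hv
  have key := norm_sub_le_of_eq_integral (f := fun t => ∫ s in (0 : ℝ)..t,
    ((fun t => ∑ j ∈ (p N).support, p N j • h j t) - v) s) hd (fun t _ => by simp)
    (R := (eLpNorm ((fun t => ∑ j ∈ (p N).support, p N j • h j t) - v) 2 (leb T)).toNNReal)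
    (by rw [ENNReal.coe_toNNReal hd.2.ne]) h0 ht
  rw [intervalIntegral.integral_same, sub_zero] at key
  refine le_trans (le_of_eq ?_) key
  have hI : ∀ j, IntervalIntegrable (fun s => p N j • h j s) volume 0 t := fun j =>
    (intervalIntegrable_of_memLp (hh j) h0 ht).smul (p N j)
  simp only [Pi.sub_apply]
  rw [intervalIntegral.integral_sub (intervalIntegrable_of_memLp (hS N) h0 ht)
    (intervalIntegrable_of_memLp hv h0 ht), intervalIntegral.integral_finsetSum fun j _ => hI j]
  simp only [intervalIntegral.integral_smul]

theorem integral_norm_sq_le {α F : Type*} [NormedAddCommGroup F] [MeasurableSpace α] {μ : Measure α} {f : α → F}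
    (hf : MemLp f 2 μ) {R : ℝ≥0} (hR : eLpNorm f 2 μ ≤ R) : ∫ t, ‖f t‖ ^ 2 ∂μ ≤ R ^ 2 := by
  have h := hf.eLpNorm_eq_integral_rpow_norm (by norm_num) (by norm_num)
  rw [h, ENNReal.ofReal_le_iff_le_toReal (by simp), ENNReal.coe_toReal] at hR
  have h0 : 0 ≤ ∫ t, ‖f t‖ ^ 2 ∂μ := integral_nonneg fun _ => by positivity
  simp only [ENNReal.toReal_ofNat, Real.rpow_ofNat] at hR
  rw [← one_div, ← Real.sqrt_eq_rpow] at hR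
  exact (Real.sqrt_le_left R.coe_nonneg).1 hR

end

/-! ### Feasible solutions -/

namespace Quadruple

variable {n m d : ℕ}

/-- The quadruple with given values of the state `(x, a, b)` and given control `u`. -/
def ofPos (y : ℝ → State n m) (u : ℝ → E d) : Quadruple n m d :=
  ⟨fun t => (y t).1, fun i t => (y t).2.1 i, fun i t => (y t).2.2 i, u⟩

theorem ofPos_vel {y : ℝ → State n m} {u : ℝ → E d} {w : State n m} {t : ℝ}
    (h : HasDerivAt y w t) : (ofPos y u).vel t = w := by
  have h1 := (ContinuousLinearMap.fst ℝ (E n) ((Fin m → E n) × (Fin m → ℝ))).hasFDerivAt.comp_hasDerivAt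
    t h
  have h2 := (ContinuousLinearMap.snd ℝ (E n) ((Fin m → E n) × (Fin m → ℝ))).hasFDerivAt.comp_hasDerivAt
    t h
  have h3 := hasDerivAt_pi.1 ((ContinuousLinearMap.fst ℝ (Fin m → E n)
    (Fin m → ℝ)).hasFDerivAt.comp_hasDerivAt t h2)
  have h4 := hasDerivAt_pi.1 ((ContinuousLinearMap.snd ℝ (Fin m → E n)
    (Fin m → ℝ)).hasFDerivAt.comp_hasDerivAt t h2)
  exact Prod.ext h1.deriv (Prod.ext (funext fun i => (h3 i).deriv) (funext fun i => (h4 i).deriv))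

end Quadruple

namespace Problem

variable {n m d : ℕ} {P : Problem n m d} {q : Quadruple n m d}

/-- The initial value of the state `(x, a, b)`. -/
def init (P : Problem n m d) : State n m := (P.x₀, P.a₀, P.b₀)

/-- The values of the perturbation along a quadruple. -/
def perturbation (P : Problem n m d) (q : Quadruple n m d) (t : ℝ) : E n := P.g (q.x t) (q.u t)

/-- The running cost as a function of time and of the pair of the state and its velocity. -/
def stateCost (P : Problem n m d) (t : ℝ) (z : State n m × State n m) : EReal := P.ℓ t z.1 0 z.2

/-- The control `0` in `stateCost` is a placeholder that may lie outside `P.U`; independence holds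
for all control values. -/
theorem runningCost_eq (hi : P.CostIndepControl) {t : ℝ} (ht : t ∈ Icc 0 P.T) :
    P.runningCost q t = P.stateCost t (q.pos t, q.vel t) := hi t ht _ _ _ _

namespace Feasible

theorem isW12_pos (hq : P.Feasible q) : IsW12 P.T q.pos :=
  Quadruple.isW12_pos hq.x_w12 hq.controls.a_w12 hq.controls.b_w12

theorem pos_zero (hq : P.Feasible q) : q.pos 0 = P.init :=
  Prod.ext hq.x_init (Prod.ext (funext hq.controls.a_init) (funext hq.controls.b_init))

theorem deriv_pos_ae_eq (hT : 0 < P.T) (hq : P.Feasible q) : deriv q.pos =ᵐ[leb P.T] q.vel :=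
  Quadruple.deriv_pos_ae_eq hT hq.x_w12 hq.controls.a_w12 hq.controls.b_w12

theorem memLp_vel (hT : 0 < P.T) (hq : P.Feasible q) : MemLp q.vel 2 (leb P.T) :=
  (hq.isW12_pos.memLp_deriv hT).ae_eq (hq.deriv_pos_ae_eq hT)

theorem pos_eq_integral (hT : 0 < P.T) (hq : P.Feasible q) {t : ℝ} (ht : t ∈ Icc 0 P.T) :
    q.pos t = P.init + ∫ s in (0 : ℝ)..t, q.vel s := by
  rw [hq.isW12_pos.eq_integral_deriv hT t ht, hq.pos_zero,
    integral_congr_leb (hq.deriv_pos_ae_eq hT) ht]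

theorem norm_pos_sub_le (hT : 0 < P.T) (hq : P.Feasible q) {R : ℝ≥0}
    (hR : eLpNorm q.vel 2 (leb P.T) ≤ R) {s t : ℝ} (hs : s ∈ Icc 0 P.T) (ht : t ∈ Icc 0 P.T) :
    ‖q.pos t - q.pos s‖ ≤ R * √|t - s| :=
  norm_sub_le_of_eq_integral (hq.memLp_vel hT)
    (fun t ht => by rw [hq.pos_zero]; exact hq.pos_eq_integral hT ht) hR hs ht

theorem norm_pos_le (hT : 0 < P.T) (hq : P.Feasible q) {R : ℝ≥0}
    (hR : eLpNorm q.vel 2 (leb P.T) ≤ R) {t : ℝ} (ht : t ∈ Icc 0 P.T) :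
    ‖q.pos t‖ ≤ ‖P.init‖ + R * √P.T := by
  have h := hq.norm_pos_sub_le hT hR ⟨le_rfl, hT.le⟩ ht
  rw [hq.pos_zero, sub_zero, abs_of_nonneg ht.1] at h
  have h2 : ‖q.pos t‖ ≤ ‖P.init‖ + ‖q.pos t - P.init‖ := norm_le_insert' _ _
  have h3 : R * √t ≤ R * √P.T := by gcongr; exact ht.2
  linarith

end Feasible

theorem H3.exists_lipschitz (h3 : P.H3) : ∃ L : ℝ≥0,
    (∀ x₁ x₂, ∀ u ∈ P.U, ‖P.g x₁ u - P.g x₂ u‖ ≤ L * ‖x₁ - x₂‖) ∧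
    LipschitzOnWith L (Function.uncurry P.g) (univ ×ˢ P.U) ∧
    (∀ u ∈ P.U, Continuous fun x => P.g x u) ∧ ∀ x, ContinuousOn (P.g x) P.U := by
  obtain ⟨⟨L, hL, hg⟩, -⟩ := h3
  have h1 : ∀ x₁ x₂, ∀ u ∈ P.U, ‖P.g x₁ u - P.g x₂ u‖ ≤ L * ‖x₁ - x₂‖ := fun x₁ x₂ u hu => by
    simpa using hg x₁ x₂ u hu u hu
  -- The factor `2` appears because the product carries the maximum norm.
  have h2 : LipschitzOnWith (2 * L.toNNReal) (Function.uncurry P.g) (univ ×ˢ P.U) := by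
    refine LipschitzOnWith.of_dist_le_mul fun z hz z' hz' => ?_
    rw [dist_eq_norm]
    refine (hg z.1 z'.1 z.2 hz.2 z'.2 hz'.2).trans ?_
    have := norm_fst_le (z - z')
    have := norm_snd_le (z - z')
    rw [dist_eq_norm, NNReal.coe_mul, Real.coe_toNNReal L hL.le, NNReal.coe_ofNat]
    simp only [Prod.fst_sub, Prod.snd_sub] at *
    nlinarith
  refine ⟨2 * L.toNNReal, fun x₁ x₂ u hu => (h1 x₁ x₂ u hu).trans ?_, h2, fun u hu => ?_,
    fun x => ?_⟩
  · rw [NNReal.coe_mul, Real.coe_toNNReal L hL.le, NNReal.coe_ofNat]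
    nlinarith [mul_nonneg hL.le (norm_nonneg (x₁ - x₂))]
  · exact h2.continuousOn.comp_continuous (f := fun x => (x, u)) (by fun_prop)
      fun x => ⟨mem_univ _, hu⟩
  · exact h2.continuousOn.comp (f := fun u => (x, u)) (by fun_prop) fun u hu => ⟨mem_univ _, hu⟩

theorem Feasible.aestronglyMeasurable_perturbation (h1 : P.H1) (h3 : P.H3) (hq : P.Feasible q) :
    AEStronglyMeasurable (P.perturbation q) (leb P.T) := by
  classical
  obtain ⟨L, -, hL, -, -⟩ := h3.exists_lipschitz
  -- `P.g` is uncontrolled off `P.U`, so it is replaced there by `0`; almost every `(q.x t, q.u t)`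
  -- lies in the closed set `univ ×ˢ P.U`.
  have hm : Measurable ((univ ×ˢ P.U).piecewise (Function.uncurry P.g) 0) :=
    hL.continuousOn.measurable_piecewise continuousOn_const
      (MeasurableSet.univ.prod h1.1.measurableSet)
  have hxu : AEMeasurable (fun t => (q.x t, q.u t)) (leb P.T) :=
    hq.x_w12.aestronglyMeasurable.aemeasurable.prodMk hq.u_l2.1.aemeasurable
  refine ((hm.comp_aemeasurable hxu).congr ?_).aestronglyMeasurable
  filter_upwards [hq.u_mem] with t ht
  exact piecewise_eq_of_mem _ _ _ (⟨mem_univ _, ht⟩ : (q.x t, q.u t) ∈ univ ×ˢ P.U)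

theorem Feasible.mem_normalCone (hq : P.Feasible q) :
    ∀ᵐ t ∂(leb P.T), P.perturbation q t - (q.vel t).1 ∈ normalCone (q.x t) (q.C t) := by
  filter_upwards [hq.inclusion] with t ht
  obtain ⟨ζ, hζ, h⟩ := ht
  have : P.perturbation q t - (q.vel t).1 = ζ := by
    change P.g (q.x t) (q.u t) - deriv q.x t = ζ
    rw [h]; abel
  rwa [this]

/-- The perturbations along feasible solutions with bounded velocities are bounded. -/
theorem exists_perturbation_bound (hT : 0 < P.T) (h1 : P.H1) (h3 : P.H3) (R : ℝ≥0) :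
    ∃ B : ℝ≥0, ∀ q, P.Feasible q → eLpNorm q.vel 2 (leb P.T) ≤ R →
      MemLp (P.perturbation q) 2 (leb P.T) ∧ eLpNorm (P.perturbation q) 2 (leb P.T) ≤ B := by
  obtain ⟨-, M, hM, hg⟩ := id h3
  set C : ℝ := M * (1 + (‖P.init‖ + R * √P.T))
  have htop : (leb P.T) univ ^ (2 : ℝ≥0∞).toReal⁻¹ * ENNReal.ofReal C ≠ ⊤ :=
    ENNReal.mul_ne_top (ENNReal.rpow_ne_top_of_nonneg (by simp) (measure_ne_top _ _))
      ENNReal.ofReal_ne_top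
  refine ⟨((leb P.T) univ ^ (2 : ℝ≥0∞).toReal⁻¹ * ENNReal.ofReal C).toNNReal, fun q hq hR => ?_⟩
  have hb : ∀ᵐ t ∂(leb P.T), ‖P.perturbation q t‖ ≤ C := by
    filter_upwards [hq.u_mem, ae_leb_mem P.T] with t hu ht
    refine (hg _ _ hu).trans ?_
    have : ‖q.x t‖ ≤ ‖q.pos t‖ := norm_fst_le (q.pos t)
    have := hq.norm_pos_le hT hR ht
    simp only [C]
    gcongr
    linarith
  refine ⟨.of_bound (hq.aestronglyMeasurable_perturbation h1 h3) C hb, ?_⟩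
  rw [ENNReal.coe_toNNReal htop]
  exact eLpNorm_le_of_ae_bound hb

/-- Pointwise bounds on linear images pass to limits of tail convex combinations. -/
theorem norm_le_of_tail_combination {W V : Type*} [NormedAddCommGroup W] [NormedSpace ℝ W]
    [NormedAddCommGroup V] [NormedSpace ℝ V] (A : W →L[ℝ] V) {p : ℕ → ℕ →₀ ℝ}
    (hp : ∀ N, IsTailWeights N (p N)) {w : ℕ → W} {w₀ : W}
    (hw : Tendsto (fun N => ∑ j ∈ (p N).support, p N j • w j) atTop (𝓝 w₀)) {K : ℝ}
    (hK : ∀ j, ‖A (w j)‖ ≤ K) : ‖A w₀‖ ≤ K := by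
  have hcl : IsClosed {w | ‖A w‖ ≤ K} := isClosed_le (by fun_prop) continuous_const
  have hcv : Convex ℝ {w | ‖A w‖ ≤ K} := by
    have : {w | ‖A w‖ ≤ K} = A.toLinearMap ⁻¹' Metric.closedBall 0 K := by ext; simp
    rw [this]
    exact (convex_closedBall 0 K).linear_preimage _
  exact hcl.mem_of_tendsto hw (.of_forall fun N => (hp N).sum_mem hcv fun j _ => hK j)

/-- Closedness of the set of feasible solutions and lower semicontinuity of the integral cost. -/
theorem exists_feasible_limit (hT : 0 < P.T) (h1 : P.H1) (h3 : P.H3) (h4 : P.H4) (h5 : P.H5)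
    (hindep : P.CostIndepControl) (hconv : P.CostConvexVel) {q : ℕ → Quadruple n m d}
    (hq : ∀ k, P.Feasible (q k)) {R : ℝ≥0} (hR : ∀ k, eLpNorm (q k).vel 2 (leb P.T) ≤ R)
    (hgconv : ∀ k, ∀ t ∈ Icc (0 : ℝ) P.T, Convex ℝ (P.g ((q k).x t) '' P.U))
    {y : ℝ → State n m} (hy : ∀ t ∈ Icc (0 : ℝ) P.T, Tendsto (fun k => (q k).pos t) atTop (𝓝 (y t)))
    (hζ : ∀ᵐ t ∂(leb P.T), Tendsto (fun k => ‖P.perturbation (q k) t - ((q k).vel t).1‖ *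
      ‖(q k).x t - (y t).1‖) atTop (𝓝 0))
    {I : ℝ} (hI : Tendsto (fun k => ∫ t, (P.runningCost (q k) t).toReal ∂(leb P.T)) atTop (𝓝 I)) :
    ∃ q', P.Feasible q' ∧ q'.x P.T = (y P.T).1 ∧
      ∫ t, (P.runningCost q' t).toReal ∂(leb P.T) ≤ I := by
  obtain ⟨B, hB⟩ := exists_perturbation_bound hT h1 h3 R
  obtain ⟨L, hL, -, hgx, hgu⟩ := h3.exists_lipschitz
  obtain ⟨-, -, ⟨c, hc⟩, hlsc, hcont⟩ := h5
  have hUc : IsCompact P.U := Metric.isCompact_of_isClosed_isBounded h1.1 h1.2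
  -- tail convex combinations of the velocities and of the perturbations
  set h : ℕ → ℝ → State n m × E n := fun k t => ((q k).vel t, P.perturbation (q k) t) with hh
  have hhL : ∀ k, MemLp (h k) 2 (leb P.T) := fun k =>
    .of_fst_snd ⟨(hq k).memLp_vel hT, (hB _ (hq k) (hR k)).1⟩
  have hhR : ∀ k, eLpNorm (h k) 2 (leb P.T) ≤ (R + B : ℝ≥0) := fun k => by
    have hv := ((hq k).memLp_vel hT).1.norm
    have hp := (hB _ (hq k) (hR k)).1.1.norm
    calc eLpNorm (h k) 2 (leb P.T)
        ≤ eLpNorm ((fun t => ‖(q k).vel t‖) + fun t => ‖P.perturbation (q k) t‖) 2 (leb P.T) :=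
          eLpNorm_mono fun t => by
            refine le_trans ?_ (le_abs_self _)
            exact max_le_add_of_nonneg (norm_nonneg _) (norm_nonneg _)
      _ ≤ _ := eLpNorm_add_le hv hp (by norm_num)
      _ ≤ (R + B : ℝ≥0) := by
          rw [eLpNorm_norm, eLpNorm_norm, ENNReal.coe_add]
          exact add_le_add (hR k) (hB _ (hq k) (hR k)).2
  -- The same weights serve velocities and perturbations, so their differences, the normals,
  -- converge along them too.
  obtain ⟨p, hp, H, hHL, hlim, hae⟩ := exists_tail_combination_tendsto_ae hhL hhR
  set v : ℝ → State n m := fun t => (H t).1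
  set γ : ℝ → E n := fun t => (H t).2
  have hvL : MemLp v 2 (leb P.T) := hHL.fst
  have hγL : MemLp γ 2 (leb P.T) := hHL.snd
  have hvae : ∀ᵐ t ∂(leb P.T),
      Tendsto (fun N => ∑ j ∈ (p N).support, p N j • (q j).vel t) atTop (𝓝 (v t)) := by
    filter_upwards [hae] with t ht
    simpa [Function.comp_def, Prod.fst_sum, hh] using! (continuous_fst.tendsto (H t)).comp ht
  have hγae : ∀ᵐ t ∂(leb P.T),
      Tendsto (fun N => ∑ j ∈ (p N).support, p N j • P.perturbation (q j) t) atTop (𝓝 (γ t)) := by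
    filter_upwards [hae] with t ht
    simpa [Function.comp_def, Prod.snd_sum, hh] using! (continuous_snd.tendsto (H t)).comp ht
  -- the limit state is the integral of the limit velocity
  have h0 : (0 : ℝ) ∈ Icc 0 P.T := ⟨le_rfl, hT.le⟩
  have hy0 : y 0 = P.init :=
    tendsto_nhds_unique (hy 0 h0) (by simp only [(hq _).pos_zero]; exact tendsto_const_nhds)
  have hyint : ∀ t ∈ Icc (0 : ℝ) P.T, y t = y 0 + ∫ s in (0 : ℝ)..t, v s := by
    intro t ht
    refine tendsto_nhds_unique (tendsto_tail_combination hp (hy t ht)) ?_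
    have hF := fun {k : ℝ → State n m × E n} (hk : MemLp k 2 (leb P.T)) =>
      (ContinuousLinearMap.fst ℝ (State n m) (E n)).intervalIntegral_comp_comm
        (intervalIntegrable_of_memLp hk h0 ht)
    have h6 := ((continuous_fst.tendsto _).comp
      (tendsto_integral_tail_combination hhL hHL hlim ht)).const_add (y 0)
    have h7 := hF hHL
    simp only [ContinuousLinearMap.coe_fst'] at h7
    rw [← h7] at h6
    refine h6.congr fun N => ?_
    have h8 : ∀ j, (q j).pos t = y 0 + (∫ s in (0 : ℝ)..t, h j s).1 := fun j => by
      rw [(hq j).pos_eq_integral hT ht, hy0]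
      exact congrArg (P.init + ·) (hF (hhL j))
    simp only [h8, smul_add, Finset.sum_add_distrib, ← Finset.sum_smul, (hp N).sum_eq_one, one_smul,
      Function.comp_apply, Prod.fst_sum, Prod.smul_fst]
  have hyW : IsW12 P.T y := ⟨v, hvL, hyint⟩
  have hyd : ∀ᵐ t ∂(leb P.T), HasDerivAt y (v t) t := ae_hasDerivAt_of_eq_integral hT hvL hyint
  set π₁ := ContinuousLinearMap.fst ℝ (E n) ((Fin m → E n) × (Fin m → ℝ))
  set πa : Fin m → State n m →L[ℝ] E n := fun i =>
    (ContinuousLinearMap.proj (R := ℝ) (φ := fun _ : Fin m => E n) i).comp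
    ((ContinuousLinearMap.fst ℝ (Fin m → E n) (Fin m → ℝ)).comp
      (ContinuousLinearMap.snd ℝ (E n) ((Fin m → E n) × (Fin m → ℝ))))
  set πb : Fin m → State n m →L[ℝ] ℝ := fun i =>
    (ContinuousLinearMap.proj (R := ℝ) (φ := fun _ : Fin m => ℝ) i).comp
    ((ContinuousLinearMap.snd ℝ (Fin m → E n) (Fin m → ℝ)).comp
      (ContinuousLinearMap.snd ℝ (E n) ((Fin m → E n) × (Fin m → ℝ))))
  have hxt : ∀ t ∈ Icc (0 : ℝ) P.T, Tendsto (fun k => (q k).x t) atTop (𝓝 (y t).1) :=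
    fun t ht => (π₁.continuous.tendsto _).comp (hy t ht)
  have hat : ∀ t ∈ Icc (0 : ℝ) P.T, ∀ i, Tendsto (fun k => (q k).a i t) atTop (𝓝 ((y t).2.1 i)) :=
    fun t ht i => ((πa i).continuous.tendsto _).comp (hy t ht)
  have hbt : ∀ t ∈ Icc (0 : ℝ) P.T, ∀ i, Tendsto (fun k => (q k).b i t) atTop (𝓝 ((y t).2.2 i)) :=
    fun t ht i => ((πb i).continuous.tendsto _).comp (hy t ht)
  -- selection of the control
  have hg : ∀ᵐ t ∂(leb P.T), γ t ∈ P.g (y t).1 '' P.U := by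
    filter_upwards [ae_leb_mem P.T, hγae, ae_all_iff.2 fun k => (hq k).u_mem] with t ht h6 h7
    exact mem_image_of_tail_combination hL (hUc.image_of_continuousOn (hgu _)).isClosed (hxt t ht)
      (fun k => hgconv k t ht) hp h7 h6
  have : (ae (leb P.T)).NeBot := by
    rw [ae_neBot, ← Measure.measure_univ_ne_zero, leb, Measure.restrict_apply_univ, Real.volume_Icc]
    simpa using hT
  have hUne : P.U.Nonempty := (hq 0).u_mem.exists.imp' _ fun _ => id
  have hxm : AEMeasurable (fun t => (y t).1) (leb P.T) :=
    (hyW.clm_comp π₁).aestronglyMeasurable.aemeasurable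
  have hγm := hγL.1.aemeasurable
  obtain ⟨u, hum, huU, hu⟩ := exists_measurable_zero (μ := leb P.T) hUc hUne
    (h := fun t c => ‖P.g (hxm.mk _ t) c - hγm.mk _ t‖)
    (fun c hc => (((hgx c hc).measurable.comp hxm.measurable_mk).sub hγm.measurable_mk).norm)
    (fun t => ((hgu _).sub continuousOn_const).norm) (fun t c _ => norm_nonneg _)
    (by
      filter_upwards [hg, hxm.ae_eq_mk, hγm.ae_eq_mk] with t h6 h7 h8
      obtain ⟨c, hcU, hcg⟩ := h6
      exact ⟨c, hcU, by rw [← h7, ← h8, hcg, sub_self, norm_zero]⟩)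
  have hgu' : ∀ᵐ t ∂(leb P.T), P.g (y t).1 (u t) = γ t := by
    filter_upwards [hu, hxm.ae_eq_mk, hγm.ae_eq_mk] with t h6 h7 h8
    rw [h7, h8]
    exact sub_eq_zero.1 (norm_eq_zero.1 h6)
  -- the limit quadruple
  set q' := Quadruple.ofPos y u with hq'
  have hvel : ∀ᵐ t ∂(leb P.T), q'.vel t = v t := by
    filter_upwards [hyd] with t ht using Quadruple.ofPos_vel ht
  have hadm : P.AdmissibleControls q'.a q'.b :=
    { a_w12 := fun i => hyW.clm_comp (πa i)
      b_w12 := fun i => hyW.clm_comp (πb i)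
      a_init := fun i => congrArg (πa i) hy0
      b_init := fun i => congrArg (πb i) hy0
      a_bound := fun i => by
        filter_upwards [hvel, hvae, ae_all_iff.2 fun k => (hq k).controls.a_bound i] with t h6 h7 h8
        have h9 := norm_le_of_tail_combination (πa i) hp h7 h8
        rwa [← h6] at h9
      b_bound := fun i => by
        filter_upwards [hvel, hvae, ae_all_iff.2 fun k => (hq k).controls.b_bound i] with t h6 h7 h8
        have h9 := norm_le_of_tail_combination (πb i) hp h7 h8
        rwa [← h6] at h9
      a_unit := fun i t ht => tendsto_nhds_unique (hat t ht i).norm (by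
        simp only [(hq _).controls.a_unit i t ht]; exact tendsto_const_nhds) }
  have hxC : ∀ t ∈ Icc (0 : ℝ) P.T, q'.x t ∈ q'.C t := fun t ht i =>
    le_of_tendsto_of_tendsto' ((hat t ht i).inner (hxt t ht)) (hbt t ht i)
      fun k => (hq k).x_mem t ht i
  -- The Slater condition is needed for the limit polyhedra, hence admissibility of the limit
  -- controls comes beforehand.
  obtain ⟨-, θ, -, ⟨δ, hδ, hθδ⟩, hθ⟩ := h4 q'.a q'.b hadm
  have hcone : ∀ᵐ t ∂(leb P.T), γ t - (v t).1 ∈ normalCone (q'.x t) (q'.C t) := by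
    filter_upwards [ae_leb_mem P.T, hvae, hγae, hζ, ae_all_iff.2 fun k => (hq k).mem_normalCone]
      with t ht h6 h7 h8 h9
    obtain ⟨z, hz⟩ := hθ t ht
    refine mem_normalCone_of_tail_combination (hat t ht) (hbt t ht) h9 h8 (hxC t ht) hp ?_
      (z := z) fun i => ?_
    · have := h7.sub ((continuous_fst.tendsto _).comp h6)
      simpa [smul_sub, Finset.sum_sub_distrib, Function.comp_def, Prod.fst_sum] using! this
    · exact sub_neg.1 ((hz i).trans ((hθδ t ht).trans_lt hδ))
  -- the cost
  have hcost := integral_le_of_tail_combination (μ := leb P.T) (f := P.stateCost) (c := c)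
    (y := fun k => (q k).pos) (y₀ := y) (w := fun k => (q k).vel) (w₀ := v) (R := R ^ 2)
    (l := fun k t => (P.runningCost (q k) t).toReal) (I := I)
    (by
      filter_upwards [hlsc] with t ht
      exact ht.comp (g := fun z : State n m × State n m => (z.1, (0 : E d), z.2)) (by fun_prop))
    (by filter_upwards [hc] with t ht z using ht _ _ _)
    (by filter_upwards [hconv] with t ht z using ht z 0)
    (by filter_upwards [ae_leb_mem P.T] with t ht using hy t ht)
    hp hvae (fun k => (hq k).memLp_vel hT)
    (fun k => integral_norm_sq_le ((hq k).memLp_vel hT) (hR k))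
    (fun k => by
      filter_upwards [ae_leb_mem P.T, (hq k).cost_finite] with t ht h6
      rw [EReal.coe_toReal h6.1 h6.2, runningCost_eq hindep ht])
    (fun k => (hq k).cost_integrable) hI
    (aemeasurable_superposition (S := Icc 0 P.T) (ae_leb_mem P.T) (f := P.stateCost)
      (by
        filter_upwards [hlsc] with t ht
        exact ht.comp (g := fun z : State n m × State n m => (z.1, (0 : E d), z.2)) (by fun_prop))
      (by filter_upwards [hcont] with t ht z using ht _ _ _)
      (hyW.aestronglyMeasurable.aemeasurable.prodMk hvL.1.aemeasurable))
  have hrun : ∀ᵐ t ∂(leb P.T), P.runningCost q' t = P.stateCost t (y t, v t) := by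
    filter_upwards [ae_leb_mem P.T, hvel] with t ht h6
    rw [runningCost_eq hindep ht, h6]
    rfl
  have hrun' : (fun t => (P.runningCost q' t).toReal) =ᵐ[leb P.T]
      fun t => (P.stateCost t (y t, v t)).toReal := by
    filter_upwards [hrun] with t ht
    rw [ht]
  refine ⟨q', ⟨hyW.clm_comp π₁, hadm, ?_, .of_forall huU, congrArg π₁ hy0, hxC, ?_, ?_,
    hcost.2.1.congr hrun'.symm⟩, rfl, ?_⟩
  · obtain ⟨C, hC⟩ := h1.2.exists_norm_le
    exact .of_bound hum.aestronglyMeasurable C (.of_forall fun t => hC _ (huU t))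
  · filter_upwards [hcone, hgu', hvel] with t h6 h7 h8
    refine ⟨_, h6, ?_⟩
    have h9 : deriv q'.x t = (v t).1 := congrArg Prod.fst h8
    change _ = _ + P.g (y t).1 (u t)
    rw [h9, h7]
    abel
  · filter_upwards [hrun, hcost.1] with t h6 h7
    rwa [h6]
  · rw [integral_congr_ae hrun']
    exact hcost.2.2

end Problem

end Sweeping

theorem theorem3p1 {n m d : ℕ} (P : Sweeping.Problem n m d) (hT : 0 < P.T)
    (h1 : P.H1) (h3 : P.H3) (h4 : P.H4) (h5 : P.H5)
    (hindep : P.CostIndepControl) (hconv : P.CostConvexVel)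
    (q : ℕ → Sweeping.Quadruple n m d) (hq : P.IsMinimizingSeq q)
    (hmaj : ∃ κ : ℝ → ℝ, Integrable κ (Sweeping.leb P.T) ∧
      ∀ k, ∀ᵐ t ∂(Sweeping.leb P.T), P.runningCost (q k) t ≤ (κ t : EReal))
    (hbdd : ∃ R : ℝ≥0, ∀ k, Sweeping.w12Norm P.T (q k).x ≤ R ∧
      (∀ i, Sweeping.w12Norm P.T ((q k).a i) ≤ R) ∧ (∀ i, Sweeping.w12Norm P.T ((q k).b i) ≤ R))
    (hgconv : ∀ k, ∀ t ∈ Icc (0 : ℝ) P.T, Convex ℝ (P.g ((q k).x t) '' P.U)) :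
    ∃ q' : Sweeping.Quadruple n m d, P.IsOptimal q' := by
  obtain ⟨hfeas, hJ⟩ := hq
  obtain ⟨κ, hκ, hle⟩ := hmaj
  obtain ⟨R₀, hR₀⟩ := hbdd
  obtain ⟨R, hR⟩ : ∃ R : ℝ≥0, ∀ k, eLpNorm (q k).vel 2 (Sweeping.leb P.T) ≤ R :=
    ⟨_, fun k => Sweeping.Quadruple.eLpNorm_vel_le hT (hfeas k).x_w12 (hfeas k).controls.a_w12
      (hfeas k).controls.b_w12 (hR₀ k).1 (hR₀ k).2.1 (hR₀ k).2.2⟩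
  obtain ⟨φ₁, hφ₁, y, hy⟩ := Sweeping.exists_subseq_tendstoUniformlyOn hT.le
    (f := fun k => (q k).pos) (fun k => (hfeas k).pos_zero)
    (fun k s hs t ht => (hfeas k).norm_pos_sub_le hT (hR k) hs ht)
  obtain ⟨c, hc⟩ := h5.2.2.1
  -- The majorant `κ` and the lower bound `c` confine the integral costs to a compact interval, so a
  -- subsequence converges to a finite `I`.
  have hmem : ∀ k, ∫ t, (P.runningCost (q k) t).toReal ∂(Sweeping.leb P.T) ∈
      Icc (∫ _, c ∂(Sweeping.leb P.T)) (∫ t, κ t ∂(Sweeping.leb P.T)) := fun k => by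
    refine ⟨integral_mono_ae (integrable_const c) (hfeas k).cost_integrable ?_,
      integral_mono_ae (hfeas k).cost_integrable hκ ?_⟩
    · filter_upwards [hc, (hfeas k).cost_finite] with t h6 h7
      have := h6 ((q k).pos t) ((q k).u t) ((q k).vel t)
      rw [← EReal.coe_le_coe_iff, EReal.coe_toReal h7.1 h7.2]
      exact this
    · filter_upwards [hle k, (hfeas k).cost_finite] with t h6 h7
      rwa [← EReal.coe_le_coe_iff, EReal.coe_toReal h7.1 h7.2]
  obtain ⟨I, -, φ₂, hφ₂, hI⟩ := isCompact_Icc.tendsto_subseq fun k => hmem (φ₁ k)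
  obtain ⟨B, hB⟩ := Sweeping.Problem.exists_perturbation_bound hT h1 h3 R
  set r : ℕ → ℝ → ℝ := fun k t => ‖P.perturbation (q k) t - ((q k).vel t).1‖ *
      ‖(q k).x t - (y t).1‖
  have hyx : ∀ t ∈ Icc (0 : ℝ) P.T, Tendsto (fun k => (q (φ₁ k)).pos t) atTop (𝓝 (y t)) :=
    fun t ht => hy.tendsto_at ht
  have hζm : ∀ k, AEStronglyMeasurable (fun t => P.perturbation (q k) t - ((q k).vel t).1)
      (Sweeping.leb P.T) := fun k =>
    (hB _ (hfeas k) (hR k)).1.1.sub ((hfeas k).memLp_vel hT).fst.1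
  have hym : AEStronglyMeasurable (fun t => (y t).1) (Sweeping.leb P.T) := by
    refine aestronglyMeasurable_of_tendsto_ae atTop (f := fun k => (q (φ₁ k)).x)
      (fun k => (hfeas _).x_w12.aestronglyMeasurable) ?_
    filter_upwards [Sweeping.ae_leb_mem P.T] with t ht
    exact (continuous_fst.tendsto _).comp (hyx t ht)
  have hrm : ∀ k, AEStronglyMeasurable (r k) (Sweeping.leb P.T) := fun k =>
    (hζm k).norm.mul ((hfeas k).x_w12.aestronglyMeasurable.sub hym).norm
  have hζR : ∀ k, eLpNorm (fun t => P.perturbation (q k) t - ((q k).vel t).1) 2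
      (Sweeping.leb P.T) ≤ (B + R : ℝ≥0) := fun k => by
    have hv : eLpNorm (fun t => ((q k).vel t).1) 2 (Sweeping.leb P.T) ≤ R :=
      (eLpNorm_mono fun t => norm_fst_le _).trans (hR k)
    refine (eLpNorm_sub_le (hB _ (hfeas k) (hR k)).1.1 ((hfeas k).memLp_vel hT).fst.1
      (by norm_num)).trans ?_
    rw [ENNReal.coe_add]
    exact add_le_add (hB _ (hfeas k) (hR k)).2 hv
  -- Uniform convergence of the states is multiplied by the $L^2$ bound `B + R` on the normals; a
  -- further subsequence gives convergence a.e.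
  have hr0 : Tendsto (fun k => eLpNorm (r (φ₁ (φ₂ k)) - 0) 2 (Sweeping.leb P.T)) atTop (𝓝 0) := by
    refine Tendsto.comp (g := fun k => eLpNorm (r (φ₁ k) - 0) 2 (Sweeping.leb P.T)) ?_
      hφ₂.tendsto_atTop
    refine ENNReal.tendsto_nhds_zero.2 fun ε hε => ?_
    obtain ⟨δ, hδ, hδε⟩ := ENNReal.exists_nnreal_pos_mul_lt
      (ENNReal.coe_ne_top (r := B + R)) hε.ne'
    filter_upwards [Metric.tendstoUniformlyOn_iff.1 hy δ hδ] with k hk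
    refine le_trans ?_ hδε.le
    refine (eLpNorm_le_mul_eLpNorm_of_ae_le_mul (c := (δ : ℝ))
      (g := fun t => P.perturbation (q (φ₁ k)) t - ((q (φ₁ k)).vel t).1) ?_ 2).trans ?_
    · filter_upwards [Sweeping.ae_leb_mem P.T] with t ht
      have h6 := hk t ht
      rw [dist_eq_norm, norm_sub_rev] at h6
      have h7 : ‖(q (φ₁ k)).x t - (y t).1‖ ≤ δ :=
        (norm_fst_le ((q (φ₁ k)).pos t - y t)).trans h6.le
      rw [sub_zero, norm_mul, norm_norm, norm_norm, mul_comm]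
      gcongr
    · rw [ENNReal.ofReal_coe_nnreal]
      gcongr
      exact hζR _
  obtain ⟨φ₃, hφ₃, hr⟩ := (tendstoInMeasure_of_tendsto_eLpNorm (by norm_num)
    (fun k => hrm (φ₁ (φ₂ k))) aestronglyMeasurable_const hr0).exists_seq_tendsto_ae
  set σ : ℕ → ℕ := fun k => φ₁ (φ₂ (φ₃ k))
  have hσ : Tendsto σ atTop atTop :=
    hφ₁.tendsto_atTop.comp (hφ₂.tendsto_atTop.comp hφ₃.tendsto_atTop)
  have hyσ : ∀ t ∈ Icc (0 : ℝ) P.T, Tendsto (fun k => (q (σ k)).pos t) atTop (𝓝 (y t)) :=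
    fun t ht => (hyx t ht).comp (hφ₂.tendsto_atTop.comp hφ₃.tendsto_atTop)
  have hIσ := hI.comp hφ₃.tendsto_atTop
  obtain ⟨q', hq', hqT, hqI⟩ := Sweeping.Problem.exists_feasible_limit hT h1 h3 h4 h5 hindep hconv
    (q := fun k => q (σ k)) (fun k => hfeas _) (fun k => hR _) (fun k => hgconv _) hyσ hr hIσ
  refine ⟨q', hq', fun q'' hq'' => ?_⟩
  refine le_trans ?_ (iInf_le (fun q : {q // P.Feasible q} => P.J q) ⟨q'', hq''⟩)
  change P.J q' ≤ P.value
  have hxT : Tendsto (fun k => (q (σ k)).x P.T) atTop (𝓝 (y P.T).1) :=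
    (continuous_fst.tendsto _).comp (hyσ P.T ⟨hT.le, le_rfl⟩)
  -- Since the integral costs are real with finite limit `I`, they can be subtracted in `EReal` even
  -- if `P.value` is infinite.
  have hφ : Tendsto (fun k => P.φ ((q (σ k)).x P.T)) atTop (𝓝 (P.value - (I : EReal))) := by
    have h6 : Tendsto (fun k => P.J (q (σ k)) +
        ((-∫ t, (P.runningCost (q (σ k)) t).toReal ∂(Sweeping.leb P.T) : ℝ) : EReal)) atTop
        (𝓝 (P.value + ((-I : ℝ) : EReal))) :=
      (EReal.continuousAt_add (p := (P.value, ((-I : ℝ) : EReal))) (by simp) (by simp)).tendsto.comp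
        ((hJ.comp hσ).prodMk_nhds (EReal.tendsto_coe.2 hIσ.neg))
    rw [EReal.coe_neg, ← sub_eq_add_neg] at h6
    refine h6.congr fun k => ?_
    rw [EReal.coe_neg, ← sub_eq_add_neg]
    exact EReal.add_sub_cancel_right
  have hφle : P.φ (y P.T).1 ≤ P.value - (I : EReal) := by
    refine le_of_forall_lt_imp_le_of_dense fun b hb => ge_of_tendsto hφ ?_
    exact (hxT.eventually (h5.2.1 _ b hb)).mono fun _ => le_of_lt
  calc P.J q' ≤ P.φ (y P.T).1 + (I : EReal) := by
        rw [Sweeping.Problem.J, hqT]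
        exact add_le_add le_rfl (EReal.coe_le_coe_iff.2 hqI)
    _ ≤ P.value := EReal.add_le_of_le_sub hφle
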